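/- Let $V$ be a finite-dimensional real vector space with a rational structure $V(\mathbb{Q})$ (the set of vectors with rational coordinates in some fixed basis of $V$), let $C\subset V$ be an open convex cone (nonempty and stable under multiplication by positive scalars) that contains no affine line, and let $L\subset V(\mathbb{Q})$ be a lattice in $V$. Write $C^\circ\subset V^*$ for the interior of the set of linear forms that are $\ge 0$ on $C$, $L^*\subset V^*$ for the lattice of linear forms that are integral on $L$, $[\,\cdot\,]$ for the convex hull, and $C_+:=[\overline{C}\cap V(\mathbb{Q})]$. A face of a convex set $X$ is a nonempty convex subset $F\subset X$ such that every segment in $X$ that meets $F$ in a point other than an end point is contained in $F$. A rationally polyhedral cone is a (nonempty) cone in $V$ defined by finitely many affine-linear inequalities $\xi(x)+c\ge 0$ with $\xi$ a linear form that is rational on $V(\mathbb{Q})$ and $c\in\mathbb{Q}$. For a face $P$ of $[C^\circ\cap L^*]$, let $\sigma(P)$ be the set of $x\in V$ for which the function $\xi\mapsto\xi(x)$ on $[C^\circ\cap L^*]$ assumes its infimum in every point of $P$. Then: 1. for every face $P$ of $[C^\circ\cap L^*]$, $\sigma(P)$ is a rationally polyhedral cone with $\dim\sigma(P)=\operatorname{codim}P=\dim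 V-\dim P$; 2. $P\mapsto\sigma(P)$ is injective on the set of faces of $[C^\circ\cap L^*]$, and it reverses inclusions: if $P\subseteq Q$ then $\sigma(Q)\subseteq\sigma(P)$; 3. the collection $\Sigma(C,L):=\{\sigma(P)\}_P$, where $P$ runs over the faces of $[C^\circ\cap L^*]$, is a rationally polyhedral decomposition of $C_+$. That is: its members are rationally polyhedral convex cones contained in $C_+$; (i) the relative interiors of its members are pairwise disjoint and have union $C_+$; (ii) it is closed under nonempty intersections (the intersection of the members of any nonempty subcollection is a member) and under taking faces; (iii) for every rationally polyhedral cone $\Pi\subset C_+$, the collection $\{\sigma\cap\Pi\}_{\sigma\in\Sigma(C,L)}$ is finite and consists of rationally polyhedral cones. -/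

import Mathlib

/-!
Convex cones in a finite dimensional real vector space `V` with a rational structure.
The space `V` is given some norm, which only serves to fix its usual topology, and the dual
space is `StrongDual ℝ V`, i.e. the space of all linear forms on `V`.
-/

namespace RatCone

/-- A cone: a nonempty subset that is invariant under multiplication by positive scalars. -/
structure IsCone {E : Type*} [AddCommGroup E] [Module ℝ E] (K : Set E) : Prop where
  nonempty : K.Nonempty
  smul_mem : ∀ t : ℝ, 0 < t → ∀ x ∈ K, t • x ∈ K

/-- A subset is nondegenerate if it does not contain an affine line. -/
def IsNondegenerate {E : Type*} [AddCommGroup E] [Module ℝ E] (K : Set E) : Prop :=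
  ∀ x v : E, v ≠ 0 → ∃ t : ℝ, x + t • v ∉ K

/-- `F` is a (nonempty) face of `X`: a nonempty convex subset of `X` such that every segment
in `X` which meets `F` in a point that is not an end point is contained in `F`. -/
structure IsFace {E : Type*} [AddCommGroup E] [Module ℝ E] (X F : Set E) : Prop where
  nonempty : F.Nonempty
  convex : Convex ℝ F
  isExtreme : IsExtreme ℝ X F

/-- The dimension of a convex set: the dimension of the translation space of its affine span. -/
noncomputable def dim {E : Type*} [AddCommGroup E] [Module ℝ E] (K : Set E) : ℕ :=
  Module.finrank ℝ (vectorSpan ℝ K)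

section

variable {V : Type*} [NormedAddCommGroup V] [NormedSpace ℝ V]

/-- `VQ` is a rational structure on `V`: the set of vectors that have rational coordinates with
respect to some basis of `V`. -/
def IsRationalStructure (VQ : AddSubgroup V) : Prop :=
  ∃ b : Module.Basis (Fin (Module.finrank ℝ V)) ℝ V,
    ∀ x : V, x ∈ VQ ↔ ∀ i, ∃ q : ℚ, b.repr x i = (q : ℝ)

/-- The linear form `ξ` is defined over `ℚ`: it takes rational values on `VQ`. -/
def IsRationalForm (VQ : AddSubgroup V) (ξ : StrongDual ℝ V) : Prop :=
  ∀ x ∈ VQ, ∃ q : ℚ, ξ x = (q : ℝ)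

/-- A rational polyhedron: a subset defined by finitely many affine-linear inequalities
`0 ≤ ξ x + c` with `ξ` and `c` rational. -/
def IsRationalPolyhedron (VQ : AddSubgroup V) (K : Set V) : Prop :=
  ∃ S : Finset (StrongDual ℝ V × ℚ), (∀ s ∈ S, IsRationalForm VQ s.1) ∧
    K = {x : V | ∀ s ∈ S, 0 ≤ s.1 x + (s.2 : ℝ)}

/-- A rationally polyhedral cone: a cone that is a rational polyhedron. -/
structure IsRatPolyCone (VQ : AddSubgroup V) (K : Set V) : Prop where
  isCone : IsCone K
  isRationalPolyhedron : IsRationalPolyhedron VQ K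

/-- The open dual `C°`: the interior of the cone of linear forms that are `≥ 0` on `C`. -/
def openDual (C : Set V) : Set (StrongDual ℝ V) :=
  interior {ξ : StrongDual ℝ V | ∀ x ∈ C, 0 ≤ ξ x}

/-- The dual lattice `L*`: the linear forms that take integral values on `L`. -/
def dualLattice (L : Submodule ℤ V) : Set (StrongDual ℝ V) :=
  {ξ : StrongDual ℝ V | ∀ x ∈ L, ∃ n : ℤ, ξ x = (n : ℝ)}

/-- `C₊`: the convex hull of the rational points of the closure of `C`. -/
def rationalHull (VQ : AddSubgroup V) (C : Set V) : Set V :=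
  convexHull ℝ (closure C ∩ (VQ : Set V))

/-- `[C° ∩ L*]`: the convex hull of the points of the dual lattice in the open dual of `C`. -/
def dualHull (C : Set V) (L : Submodule ℤ V) : Set (StrongDual ℝ V) :=
  convexHull ℝ (openDual C ∩ dualLattice L)

/-- `σ(P)`: the set of `x` for which the function `ξ ↦ ξ x` on `[C° ∩ L*]` assumes its infimum
in every point of `P`. -/
def sigma (C : Set V) (L : Submodule ℤ V) (P : Set (StrongDual ℝ V)) : Set V :=
  {x : V | ∀ p ∈ P, IsMinOn (fun ξ : StrongDual ℝ V => ξ x) (dualHull C L) p}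

/-- `Σ(C, L)`: the collection of the `σ(P)`, where `P` runs over the faces of `[C° ∩ L*]`. -/
def sigmaCollection (C : Set V) (L : Submodule ℤ V) : Set (Set V) :=
  {s : Set V | ∃ P, IsFace (dualHull C L) P ∧ s = sigma C L P}

/-- A locally rationally polyhedral decomposition `S` of a convex cone `D`
(which will be `C₊`). -/
structure IsLocRatPolyDecomposition (VQ : AddSubgroup V) (D : Set V) (S : Set (Set V)) :
    Prop where
  isCone : ∀ s ∈ S, IsCone s
  convex : ∀ s ∈ S, Convex ℝ s
  subset : ∀ s ∈ S, s ⊆ D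
  /-- The relative interiors of the members are pairwise disjoint. -/
  disjoint : S.PairwiseDisjoint (intrinsicInterior ℝ)
  /-- The union of the relative interiors is the given cone. -/
  iUnion_eq : ⋃ s ∈ S, intrinsicInterior ℝ s = D
  /-- Closed under (arbitrary nonempty) intersections. -/
  sInter_mem : ∀ T ⊆ S, T.Nonempty → ⋂₀ T ∈ S
  /-- Closed under taking faces. -/
  face_mem : ∀ s ∈ S, ∀ F, IsFace s F → F ∈ S
  /-- The restriction to a rationally polyhedral cone in `D` is finite. -/
  finite_restrict : ∀ K, IsRatPolyCone VQ K → K ⊆ D → {t | ∃ s ∈ S, t = s ∩ K}.Finite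
  /-- The restriction to a rationally polyhedral cone in `D` consists of rationally polyhedral
  cones. -/
  ratPoly_restrict : ∀ K, IsRatPolyCone VQ K → K ⊆ D → ∀ s ∈ S, IsRatPolyCone VQ (s ∩ K)

/-- A rationally polyhedral decomposition of `D`: a locally rationally polyhedral one all of
whose members are rationally polyhedral cones. -/
structure IsRatPolyDecomposition (VQ : AddSubgroup V) (D : Set V) (S : Set (Set V)) :
    Prop extends IsLocRatPolyDecomposition VQ D S where
  ratPoly : ∀ s ∈ S, IsRatPolyCone VQ s

end

end RatCone

namespace RatCone

open Set

/-! ### Finitely generated cones and half spaces -/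

section Weyl

variable {E F : Type*} [AddCommGroup E] [Module ℝ E] [AddCommGroup F] [Module ℝ F]

/-! Write K for [C° ∩ L*]. The heart of the matter is that K looks like a finitely generated cone
near each of its points, although it may have infinitely many faces. For a lattice point a of C°,
the translate C° - a is open, convex and contains 0, and by `exists_finite_generators` the lattice
points of such a set generate a finitely generated cone. That result is proved by induction on the
dimension and compactness of the sphere of directions. Near a direction in which the set is bounded
only finitely many lattice points occur. For a recession direction d, divide by the span W of the
lattice points very close to the ray of d. Dirichlet approximation gives d ∈ W, so the dimension
drops. Generators modulo W lift, and finitely many lattice points near the ray take care of W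
itself.

Hence at a relatively interior point p of a face P, the cone of feasible directions is generated by
a finite set F of forms in L* (`exists_faceGenerators`), and σ(P) is the dual of this cone, cut out
by F. Finite cone duality then shows that P is exposed, that the span of σ(P) is the annihilator of
the directions of P, and that x lies in the relative interior of σ(P) exactly when P is the set of
all minimizers of x. This yields the dimension formula, injectivity and disjointness.

A vector outside the closure of C is unbounded below on the lattice points of C°, so σ(P) lies in
that closure; having rational generators, it lies in C₊. Conversely, on finitely many rational
vectors of the closure of C the points of C° ∩ L* take values that are natural numbers up to bounded
denominators. Dickson's lemma leaves finitely many dominating points (`exists_finite_minimal`), so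
minima exist on C₊ and only finitely many cones meet a given rationally polyhedral one in different
sets. -/

theorem mem_hull_insert {g x : E} {S : Set E} :
    x ∈ PointedCone.hull ℝ (insert g S) ↔ ∃ t : ℝ, 0 ≤ t ∧ x - t • g ∈ PointedCone.hull ℝ S := by
  rw [PointedCone.hull, Submodule.mem_span_insert]
  constructor
  · rintro ⟨a, z, hz, rfl⟩
    refine ⟨a, a.2, ?_⟩
    have : (a • g + z - (a : ℝ) • g) = z := by
      change (a : ℝ) • g + z - (a : ℝ) • g = z
      abel
    rwa [this]
  · rintro ⟨t, ht, h⟩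
    refine ⟨⟨t, ht⟩, _, h, ?_⟩
    change x = t • g + (x - t • g)
    abel

theorem hull_induction {S : Set E} {p : E → Prop} (mem : ∀ x ∈ S, p x) (zero : p 0)
    (add : ∀ x y, p x → p y → p (x + y)) (smul : ∀ (t : ℝ) x, 0 ≤ t → p x → p (t • x))
    {x : E} (hx : x ∈ PointedCone.hull ℝ S) : p x :=
  Submodule.span_induction (p := fun x _ => p x) mem zero (fun x y _ _ => add x y)
    (fun (a : {c : ℝ // 0 ≤ c}) x _ h => smul a.1 x a.2 h) hx

/-- Weyl's theorem: a finitely generated cone is the intersection of finitely many half spaces.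
The predicates `PE` and `PF` keep track of rationality. -/
theorem exists_finite_halfspaces (B : E →ₗ[ℝ] F →ₗ[ℝ] ℝ) (PE : Set E) (PF : Set F)
    (hcl : ∀ g ∈ PE, ∀ f ∈ PF, ∀ f' ∈ PF, B g f • f' - B g f' • f ∈ PF)
    (N : Set F) (hN : N.Finite) (hNF : N ⊆ PF) (hsep : ∀ x, (∀ n ∈ N, 0 ≤ B x n) → x = 0)
    {S : Set E} (hS : S.Finite) (hSE : S ⊆ PE) :
    ∃ G : Set F, G.Finite ∧ G ⊆ PF ∧
      ∀ x, x ∈ PointedCone.hull ℝ S ↔ ∀ f ∈ G, 0 ≤ B x f := by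
  induction S, hS using Set.Finite.induction_on with
  | empty =>
    refine ⟨N, hN, hNF, fun x => ?_⟩
    simp only [PointedCone.hull, Submodule.span_empty, Submodule.mem_bot]
    exact ⟨fun h => by simp [h], hsep x⟩
  | @insert g S _ _ ih =>
    obtain ⟨G, hG, hGF, h⟩ := ih fun x hx => hSE (mem_insert_of_mem _ hx)
    have hg : g ∈ PE := hSE (mem_insert _ _)
    -- Fourier–Motzkin elimination of `t` from `x - t • g ∈ hull S`: each pair of forms of opposite
    -- sign at `g` is combined into one that vanishes at `g`.
    refine ⟨{f ∈ G | 0 ≤ B g f} ∪ (fun q : F × F => B g q.2 • q.1 - B g q.1 • q.2) ''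
      {q ∈ G ×ˢ G | B g q.1 < 0 ∧ 0 < B g q.2}, ?_, ?_, fun x => ?_⟩
    · exact (hG.subset (sep_subset _ _)).union (((hG.prod hG).subset (sep_subset _ _)).image _)
    · rintro f (hf | ⟨q, ⟨⟨hq1, hq2⟩, -⟩, rfl⟩)
      · exact hGF hf.1
      · exact hcl g hg _ (hGF hq2) _ (hGF hq1)
    · rw [mem_hull_insert]
      constructor
      · rintro ⟨t, ht, hx⟩
        have hx' : ∀ f ∈ G, t * B g f ≤ B x f := fun f hf => by
          have := (h _).1 hx f hf
          simp only [map_sub, map_smul, LinearMap.sub_apply, LinearMap.smul_apply,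
            smul_eq_mul] at this
          linarith
        rintro f (hf | ⟨q, ⟨⟨hq1, hq2⟩, hn, hp⟩, rfl⟩)
        · exact (mul_nonneg ht hf.2).trans (hx' f hf.1)
        · simp only [map_sub, map_smul, smul_eq_mul]
          have h1 := mul_le_mul_of_nonneg_left (hx' _ hq1) hp.le
          have h2 := mul_le_mul_of_nonneg_left (hx' _ hq2) (neg_nonneg.2 hn.le)
          nlinarith
      · intro hx
        -- Forms negative at `g` bound `t` from below, positive ones from above; the combined forms
        -- say that every lower bound is at most every upper bound.
        have key : ∃ t : ℝ, 0 ≤ t ∧ (∀ f ∈ G, B g f < 0 → B x f / B g f ≤ t) ∧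
            ∀ f ∈ G, 0 < B g f → t ≤ B x f / B g f := by
          have hup : ∀ f ∈ G, 0 < B g f → 0 ≤ B x f / B g f := fun f hf hp =>
            div_nonneg (hx f (Or.inl ⟨hf, hp.le⟩)) hp.le
          rcases ({f ∈ G | B g f < 0}).eq_empty_or_nonempty with he | hne
          · refine ⟨0, le_rfl, fun f hf hn => ?_, hup⟩
            have : f ∈ {f ∈ G | B g f < 0} := ⟨hf, hn⟩
            simp [he] at this
          · obtain ⟨f₀, ⟨hf₀, hn₀⟩, hmax⟩ :=
              (hG.subset (sep_subset G fun f => B g f < 0)).exists_maximalFor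
                (fun f => B x f / B g f) _ hne
            have hmax' : ∀ f ∈ G, B g f < 0 → B x f / B g f ≤ B x f₀ / B g f₀ := fun f hf hn => by
              rcases le_total (B x f / B g f) (B x f₀ / B g f₀) with hle | hle
              · exact hle
              · exact hmax ⟨hf, hn⟩ hle
            refine ⟨max 0 (B x f₀ / B g f₀), le_max_left _ _,
              fun f hf hn => (hmax' f hf hn).trans (le_max_right _ _),
              fun f hf hp => max_le (hup f hf hp) ?_⟩
            have := hx _ (Or.inr ⟨(f₀, f), ⟨⟨hf₀, hf⟩, hn₀, hp⟩, rfl⟩)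
            simp only [map_sub, map_smul, smul_eq_mul] at this
            rw [← neg_div_neg_eq, div_le_div_iff₀ (by linarith) hp]
            linarith
        obtain ⟨t, ht, h1, h2⟩ := key
        refine ⟨t, ht, (h _).2 fun f hf => ?_⟩
        simp only [map_sub, map_smul, LinearMap.sub_apply, LinearMap.smul_apply, smul_eq_mul,
          sub_nonneg]
        rcases lt_trichotomy (B g f) 0 with hn | hz | hp
        · have := h1 f hf hn
          rwa [div_le_iff_of_neg hn] at this
        · rw [hz, mul_zero]
          exact hx f (Or.inl ⟨hf, hz.ge⟩)
        · have := h2 f hf hp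
          rwa [le_div_iff₀ hp] at this

/-- Weyl's theorem for the pairing with the full dual. -/
theorem exists_finite_dual_halfspaces [FiniteDimensional ℝ E] {S : Set E} (hS : S.Finite) :
    ∃ G : Set (E →ₗ[ℝ] ℝ), G.Finite ∧
      ∀ x, x ∈ PointedCone.hull ℝ S ↔ ∀ f ∈ G, 0 ≤ f x := by
  let b := Module.finBasis ℝ E
  obtain ⟨G, hG, -, h⟩ := exists_finite_halfspaces (Module.Dual.eval ℝ E) univ univ
    (fun _ _ _ _ _ _ => mem_univ _) (range b.coord ∪ range fun i => -b.coord i)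
    ((finite_range _).union (finite_range _)) (subset_univ _) (fun x hx => by
      refine b.ext_elem fun i => ?_
      have h1 := hx _ (Or.inl ⟨i, rfl⟩)
      have h2 := hx _ (Or.inr ⟨i, rfl⟩)
      simp only [Module.Dual.eval_apply, LinearMap.neg_apply, Module.Basis.coord_apply] at h1 h2
      simp only [map_zero, Finsupp.coe_zero, Pi.zero_apply]
      linarith) hS (subset_univ _)
  exact ⟨G, hG, h⟩

end Weyl

/-! ### Approximation of rays by lattice points -/

section Dirichlet

variable {E : Type*} [NormedAddCommGroup E] [NormedSpace ℝ E] [FiniteDimensional ℝ E]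

theorem exists_bounded_translate {Λ : AddSubgroup E} (hspan : Submodule.span ℝ (Λ : Set E) = ⊤) :
    ∃ R : ℝ, ∀ x : E, ∃ l ∈ Λ, ‖l - x‖ ≤ R := by
  obtain ⟨f, hf, hfs, -⟩ := Submodule.exists_fun_fin_finrank_span_eq ℝ (Λ : Set E)
  refine ⟨∑ i, ‖f i‖, fun x => ?_⟩
  have hx : x ∈ Submodule.span ℝ (range f) := by rw [hfs, hspan]; trivial
  obtain ⟨c, rfl⟩ := (Submodule.mem_span_range_iff_exists_fun ℝ).1 hx
  refine ⟨∑ i, ⌊c i⌋ • f i, Λ.sum_mem fun i _ => Λ.zsmul_mem (hf i) _, ?_⟩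
  rw [← Finset.sum_sub_distrib]
  refine (norm_sum_le _ _).trans (Finset.sum_le_sum fun i _ => ?_)
  rw [← Int.cast_smul_eq_zsmul ℝ, ← sub_smul, norm_smul]
  refine mul_le_of_le_one_left (norm_nonneg _) ?_
  rw [Real.norm_eq_abs, abs_sub_comm, abs_of_nonneg (by linarith [Int.floor_le (c i)])]
  linarith [Int.lt_floor_add_one (c i)]

/-- Dirichlet: a subgroup that spans comes arbitrarily close to any ray, arbitrarily far out. -/
theorem exists_close_to_ray {Λ : AddSubgroup E} (hspan : Submodule.span ℝ (Λ : Set E) = ⊤)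
    (d : E) {δ : ℝ} (hδ : 0 < δ) (N : ℝ) :
    ∃ μ ∈ Λ, ∃ t : ℝ, N ≤ t ∧ ‖μ - t • d‖ < δ := by
  obtain ⟨R, hR⟩ := exists_bounded_translate hspan
  choose l hl hlR using fun k : ℕ => hR ((k : ℝ) • d)
  have hcpt := isCompact_closedBall (0 : E) R
  -- Compactness replaces the pigeonhole principle: two errors far along the subsequence nearly
  -- agree, so the difference of their lattice points is close to a multiple of `d`.
  obtain ⟨a, -, φ, hφ, hlim⟩ := hcpt.tendsto_subseq (x := fun k => l k - (k : ℝ) • d)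
    (fun k => by simpa using hlR k)
  obtain ⟨M, hM⟩ := Metric.tendsto_atTop.1 hlim (δ / 2) (by positivity)
  obtain ⟨K, hK⟩ := exists_nat_ge (N + φ M)
  have hk : K ≤ φ (max M K) := (le_max_right M K).trans (hφ.id_le _)
  refine ⟨l (φ (max M K)) - l (φ M), Λ.sub_mem (hl _) (hl _), (φ (max M K) : ℝ) - φ M, ?_, ?_⟩
  · have : (K : ℝ) ≤ φ (max M K) := by exact_mod_cast hk
    linarith
  · have h1 := hM (max M K) (le_max_left _ _)
    have h2 := hM M le_rfl
    have := dist_triangle_right ((fun k => l k - (k : ℝ) • d) (φ (max M K)))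
      ((fun k => l k - (k : ℝ) • d) (φ M)) a
    rw [dist_eq_norm] at this
    calc _ = ‖(l (φ (max M K)) - (φ (max M K) : ℝ) • d) - (l (φ M) - (φ M : ℝ) • d)‖ := by
          congr 1; rw [sub_smul]; abel
      _ < δ := by simp only [Function.comp] at h1 h2; linarith

end Dirichlet

/-! ### Lattice points near a ray and finite generation -/

section Tube

variable {E : Type*} [NormedAddCommGroup E] [NormedSpace ℝ E]

/-- The points of `Λ` at distance less than `δ` from the ray spanned by `d`. -/
def tube (Λ : AddSubgroup E) (d : E) (δ : ℝ) : Set E :=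
  {l | l ∈ Λ ∧ ∃ t : ℝ, 0 ≤ t ∧ ‖l - t • d‖ < δ}

/-- The span of the points of `Λ` at distance less than `δ` from the ray spanned by `d`. -/
def tubeSpan (Λ : AddSubgroup E) (d : E) (δ : ℝ) : Submodule ℝ E :=
  Submodule.span ℝ (tube Λ d δ)

theorem tube_mono (Λ : AddSubgroup E) (d : E) {δ ε : ℝ} (h : δ ≤ ε) :
    tube Λ d δ ⊆ tube Λ d ε :=
  fun _ ⟨hl, t, ht, hlt⟩ => ⟨hl, t, ht, hlt.trans_le h⟩

theorem tube_subset {Λ : AddSubgroup E} {d : E} {ε : ℝ} {D : Set E}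
    (hε : Metric.ball 0 ε ⊆ D) (hrec : ∀ u ∈ D, ∀ t : ℝ, 0 ≤ t → u + t • d ∈ D) :
    tube Λ d ε ⊆ D := fun l ⟨_, t, ht, hlt⟩ => by
  have := hrec (l - t • d) (hε (by simpa using hlt)) t ht
  simpa using this

/-- For `a ∈ D` far out in a direction close to `d`, put `s = t / ‖a‖`. Then `u + t • d` is the
convex combination, with weight `s` on `a`, of `a` and a point that tends to `u` and hence lies in
the open set `D`. -/
theorem add_smul_mem_of_unbounded {D : Set E} (hD : IsOpen D) (hconv : Convex ℝ D) {d : E}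
    (h : ∀ U ∈ nhds d, ∀ R : ℝ, ∃ a ∈ D, R < ‖a‖ ∧ ‖a‖⁻¹ • a ∈ U) :
    ∀ u ∈ D, ∀ t : ℝ, 0 ≤ t → u + t • d ∈ D := by
  intro u hu t ht
  have hcont : ContinuousAt (fun p : ℝ × E => (1 - p.1)⁻¹ • (u + t • d - t • p.2)) (0, d) := by
    refine ContinuousAt.smul (ContinuousAt.inv₀ (by fun_prop) (by simp)) (by fun_prop)
  have hmem := hcont.preimage_mem_nhds (t := D) (hD.mem_nhds (by simpa using hu))
  rw [nhds_prod_eq, Filter.mem_prod_iff] at hmem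
  obtain ⟨V, hV, U, hU, hVU⟩ := hmem
  obtain ⟨δ, hδ, hball⟩ := Metric.mem_nhds_iff.1 hV
  obtain ⟨a, ha, hRa, haU⟩ := h U hU (max t (t / δ))
  have hta := (le_max_left _ _).trans_lt hRa
  have ha0 : 0 < ‖a‖ := ht.trans_lt hta
  have hs : t / ‖a‖ < δ := by
    have := (le_max_right _ _).trans_lt hRa
    rw [div_lt_iff₀ hδ] at this
    rw [div_lt_iff₀ ha0]; linarith
  have hs0 : 0 ≤ t / ‖a‖ := by positivity
  have hs1 : t / ‖a‖ < 1 := (div_lt_one ha0).2 hta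
  have hx : (1 - t / ‖a‖)⁻¹ • (u + t • d - t • (‖a‖⁻¹ • a)) ∈ D :=
    hVU (mk_mem_prod (hball (by simpa [abs_of_nonneg ht] using hs)) haU)
  have := hconv hx ha (sub_nonneg.2 hs1.le) hs0 (by ring)
  rwa [smul_inv_smul₀ (by linarith), smul_smul, ← div_eq_mul_inv, sub_add_cancel] at this

variable [FiniteDimensional ℝ E]

/-- The span shrinks with the radius; a radius at which its dimension is minimal works. -/
theorem exists_tubeSpan_stable (Λ : AddSubgroup E) (d : E) {ε₀ : ℝ} (hε₀ : 0 < ε₀) :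
    ∃ ε : ℝ, 0 < ε ∧ ε ≤ ε₀ ∧ ∀ δ, 0 < δ → δ ≤ ε → tubeSpan Λ d δ = tubeSpan Λ d ε := by
  obtain ⟨ε, ⟨hε, hle⟩, hmin⟩ := WellFounded.has_min
    (InvImage.wf (fun δ => Module.finrank ℝ (tubeSpan Λ d δ)) wellFounded_lt)
    {δ : ℝ | 0 < δ ∧ δ ≤ ε₀} ⟨ε₀, hε₀, le_rfl⟩
  refine ⟨ε, hε, hle, fun δ hδ hδε => ?_⟩
  refine Submodule.eq_of_le_of_finrank_le (Submodule.span_mono (tube_mono Λ d hδε)) ?_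
  exact not_lt.1 (hmin δ ⟨hδ, hδε.trans hle⟩)

/-- Rescaled lattice points of the tube approximate `d`, and the span is closed. -/
theorem mem_tubeSpan {Λ : AddSubgroup E} (hspan : Submodule.span ℝ (Λ : Set E) = ⊤)
    (d : E) {ε : ℝ} (hε : 0 < ε) : d ∈ tubeSpan Λ d ε := by
  have hcl : IsClosed (tubeSpan Λ d ε : Set E) := Submodule.closed_of_finiteDimensional _
  rw [← SetLike.mem_coe, ← hcl.closure_eq, Metric.mem_closure_iff]
  intro r hr
  obtain ⟨μ, hμ, t, ht, hlt⟩ := exists_close_to_ray hspan d (lt_min hε hr) 1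
  have ht0 : 0 < t := by linarith
  refine ⟨t⁻¹ • μ, Submodule.smul_mem _ _ (Submodule.subset_span
    ⟨hμ, t, ht0.le, hlt.trans_le (min_le_left _ _)⟩), ?_⟩
  have : d - t⁻¹ • μ = -(t⁻¹ • (μ - t • d)) := by
    rw [smul_sub, inv_smul_smul₀ ht0.ne']; abel
  rw [dist_eq_norm, this, norm_neg, norm_smul, norm_inv, Real.norm_of_nonneg ht0.le]
  calc t⁻¹ * ‖μ - t • d‖ ≤ 1 * ‖μ - t • d‖ :=
        mul_le_mul_of_nonneg_right (inv_le_one_of_one_le₀ ht) (norm_nonneg _)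
    _ < r := by rw [one_mul]; exact hlt.trans_le (min_le_right _ _)

/-- A point of `Λ` that lies in `D` modulo the tube span can be moved into `D`. -/
theorem exists_mem_of_mem_add_tubeSpan {Λ : AddSubgroup E} {d : E} {ε : ℝ} (hε : 0 < ε)
    (hst : ∀ δ, 0 < δ → δ ≤ ε → tubeSpan Λ d δ = tubeSpan Λ d ε)
    {D : Set E} (hD : IsOpen D) (hrec : ∀ u ∈ D, ∀ t : ℝ, 0 ≤ t → u + t • d ∈ D)
    {u l : E} (hu : u ∈ D) (hl : l ∈ Λ) (hul : u - l ∈ tubeSpan Λ d ε) :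
    ∃ l' ∈ Λ, l' ∈ D ∧ l' - l ∈ tubeSpan Λ d ε := by
  obtain ⟨ρ, hρ, hball⟩ := Metric.isOpen_iff.1 hD u hu
  set m := Module.finrank ℝ E with hm
  -- By stability the span may be computed in a thinner tube, so thin that at most `m` errors of
  -- size `δ` stay within the ball of radius `ρ`.
  set δ := min ε (ρ / (m + 1)) with hδ
  have hδ0 : 0 < δ := lt_min hε (by positivity)
  rw [← hst δ hδ0 (min_le_left _ _)] at hul ⊢
  obtain ⟨f, hf, hfs, hfi⟩ := Submodule.exists_fun_fin_finrank_span_eq ℝ (tube Λ d δ)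
  rw [tubeSpan, ← hfs] at hul
  obtain ⟨c, hc⟩ := (Submodule.mem_span_range_iff_exists_fun ℝ).1 hul
  choose hfΛ t ht hft using hf
  -- Rounding coefficients up moves `u` by a small vector plus a nonnegative multiple of `d`, which
  -- the recession property absorbs.
  refine ⟨l + ∑ i, ⌈c i⌉ • f i, Λ.add_mem hl (Λ.sum_mem fun i _ => Λ.zsmul_mem (hfΛ i) _), ?_, ?_⟩
  · have h1 : u + ∑ i, ((⌈c i⌉ : ℝ) - c i) • (f i - t i • d) ∈ D := by
      refine hball ?_
      rw [Metric.mem_ball, dist_eq_norm, add_sub_cancel_left]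
      refine (norm_sum_le _ _).trans_lt ?_
      have hb : ∀ i ∈ (Finset.univ : Finset (Fin (Module.finrank ℝ
          (Submodule.span ℝ (tube Λ d δ))))),
          ‖((⌈c i⌉ : ℝ) - c i) • (f i - t i • d)‖ ≤ δ := fun i _ => by
        rw [norm_smul, Real.norm_of_nonneg (by linarith [Int.le_ceil (c i)])]
        calc _ ≤ 1 * ‖f i - t i • d‖ := mul_le_mul_of_nonneg_right
              (by linarith [Int.ceil_lt_add_one (c i)]) (norm_nonneg _)
          _ ≤ δ := by rw [one_mul]; exact (hft i).le
      refine (Finset.sum_le_card_nsmul _ _ _ hb).trans_lt ?_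
      rw [Finset.card_univ, Fintype.card_fin, nsmul_eq_mul]
      have hle : (Module.finrank ℝ (Submodule.span ℝ (tube Λ d δ)) : ℝ) ≤ m := by
        exact_mod_cast Submodule.finrank_le _
      have hδ2 : δ * (m + 1) ≤ ρ := by
        rw [← le_div_iff₀ (by positivity)]; exact min_le_right _ _
      nlinarith
    have h2 := hrec _ h1 (∑ i, ((⌈c i⌉ : ℝ) - c i) * t i) (Finset.sum_nonneg fun i _ =>
      mul_nonneg (by linarith [Int.le_ceil (c i)]) (ht i))
    convert h2 using 1
    have hu' : u = l + ∑ i, c i • f i := by rw [hc]; abel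
    rw [hu', add_assoc, add_assoc, Finset.sum_smul, ← Finset.sum_add_distrib,
      ← Finset.sum_add_distrib]
    congr 1
    refine Finset.sum_congr rfl fun i _ => ?_
    rw [← Int.cast_smul_eq_zsmul ℝ]
    module
  · rw [add_sub_cancel_left]
    refine Submodule.sum_mem _ fun i _ => zsmul_mem ?_ _
    exact Submodule.subset_span ⟨hfΛ i, t i, ht i, hft i⟩

/-- Finitely many points of the tube positively span around `d`. -/
theorem exists_finite_positive_span {Λ : AddSubgroup E}
    (hspan : Submodule.span ℝ (Λ : Set E) = ⊤) {d : E} {ε : ℝ} (hε : 0 < ε)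
    (hst : ∀ δ, 0 < δ → δ ≤ ε → tubeSpan Λ d δ = tubeSpan Λ d ε) :
    ∃ S : Set E, S.Finite ∧ S ⊆ tube Λ d ε ∧ ∀ f : E →ₗ[ℝ] ℝ, (∀ s ∈ S, 0 ≤ f s) → f d ≤ 0 →
      ∀ w ∈ tubeSpan Λ d ε, f w = 0 := by
  have hd := mem_tubeSpan hspan d hε
  have hW : tubeSpan Λ d (ε / 2) = tubeSpan Λ d ε := hst _ (by positivity) (by linarith)
  obtain ⟨m, v, hv, hvs, hvi⟩ : ∃ (m : ℕ) (v : Fin m → E), (∀ i, v i ∈ tube Λ d (ε / 2)) ∧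
      Submodule.span ℝ (range v) = Submodule.span ℝ (tube Λ d (ε / 2)) ∧
      LinearIndependent ℝ v :=
    ⟨_, Submodule.exists_fun_fin_finrank_span_eq ℝ (tube Λ d (ε / 2))⟩
  have hvW : Submodule.span ℝ (range v) = tubeSpan Λ d ε := by rw [hvs, ← hW]; rfl
  choose hvΛ t ht hvt using hv
  -- The bound `1 / (m + 1)` makes the sum of `m` such terms a strict contraction in the final
  -- estimate.
  have hsmall : ∃ κ : ℝ, 0 < κ ∧ ∀ η ∈ tubeSpan Λ d ε, ‖η‖ < κ →
      ∃ c : Fin m → ℝ, ∑ i, c i • v i = η ∧ ∀ i, |c i| ≤ 1 / (m + 1) := by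
    let b := Module.Basis.span hvi
    have hcont : Continuous b.equivFun :=
      LinearMap.continuous_of_finiteDimensional
        (b.equivFun : Submodule.span ℝ (range v) →ₗ[ℝ] (Fin m → ℝ))
    have := Metric.continuousAt_iff.1 (hcont.continuousAt (x := 0)) (1 / (m + 1)) (by positivity)
    obtain ⟨κ, hκ, hb⟩ := this
    refine ⟨κ, hκ, fun η hη hlt => ?_⟩
    rw [← hvW] at hη
    have h1 : dist (⟨η, hη⟩ : Submodule.span ℝ (range v)) 0 < κ := by simpa using hlt
    refine ⟨b.equivFun ⟨η, hη⟩, ?_, fun i => ?_⟩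
    · have := congrArg Subtype.val (b.sum_equivFun ⟨η, hη⟩)
      simpa [b, Module.Basis.span_apply] using this
    · have := (dist_le_pi_dist (b.equivFun ⟨η, hη⟩) (b.equivFun 0) i).trans (hb h1).le
      simpa using this
  obtain ⟨κ, hκ, hcoord⟩ := hsmall
  -- Taking `T ≥ ∑ i, t i` keeps each `μ - v i` in the tube. A form `f ≥ 0` on all `v i` and `μ - v
  -- i` with `f d ≤ 0` has `f (v i) ≤ f μ ≤ f (μ - T • d)`, which is at most `1 / (m + 1)` times `∑
  -- k, f (v k)`.
  obtain ⟨μ, hμ, T, hT, hμT⟩ := exists_close_to_ray hspan d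
    (lt_min hκ (by positivity : (0 : ℝ) < ε / 2)) (∑ i, t i)
  have hT0 : 0 ≤ T := (Finset.sum_nonneg fun i _ => ht i).trans hT
  have htT : ∀ i, t i ≤ T := fun i =>
    (Finset.single_le_sum (fun j _ => ht j) (Finset.mem_univ i)).trans hT
  have hμW : μ ∈ tubeSpan Λ d ε := Submodule.subset_span
    ⟨hμ, T, hT0, hμT.trans_le ((min_le_right _ _).trans (by linarith))⟩
  obtain ⟨c, hc, hc1⟩ := hcoord (μ - T • d) (Submodule.sub_mem _ hμW (Submodule.smul_mem _ _ hd))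
    (hμT.trans_le (min_le_left _ _))
  refine ⟨range v ∪ range fun i => μ - v i, (finite_range _).union (finite_range _), ?_, ?_⟩
  · rintro _ (⟨i, rfl⟩ | ⟨i, rfl⟩)
    · exact tube_mono Λ d (by linarith) ⟨hvΛ i, t i, ht i, hvt i⟩
    · refine ⟨Λ.sub_mem hμ (hvΛ i), T - t i, sub_nonneg.2 (htT i), ?_⟩
      have : μ - v i - (T - t i) • d = (μ - T • d) - (v i - t i • d) := by module
      simp only [this]
      have h1 := hvt i
      have h2 := hμT.trans_le (min_le_right _ _)
      linarith [norm_sub_le (μ - T • d) (v i - t i • d)]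
  · intro f hf hfd
    have h0 : ∀ i, 0 ≤ f (v i) := fun i => hf _ (Or.inl ⟨i, rfl⟩)
    have hle : ∀ i, f (v i) ≤ 1 / (m + 1) * ∑ k, f (v k) := fun i => by
      have h1 := hf _ (Or.inr ⟨i, rfl⟩)
      have h2 : f (μ - T • d) = ∑ k, c k * f (v k) := by rw [← hc]; simp
      have h3 : ∑ k, c k * f (v k) ≤ ∑ k, 1 / (m + 1) * f (v k) := Finset.sum_le_sum fun k _ =>
        mul_le_mul_of_nonneg_right ((le_abs_self _).trans (hc1 k)) (h0 k)
      rw [← Finset.mul_sum, ← h2] at h3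
      simp only [map_sub, map_smul, smul_eq_mul] at h1 h3
      nlinarith [mul_nonneg hT0 (neg_nonneg.2 hfd)]
    have hsum : ∑ k, f (v k) ≤ 0 := by
      have h1 := Finset.sum_le_sum fun i (_ : i ∈ (Finset.univ : Finset (Fin m))) => hle i
      rw [Finset.sum_const, Finset.card_univ, Fintype.card_fin, nsmul_eq_mul, ← mul_assoc] at h1
      by_contra! hpos
      have h2 : (m : ℝ) * (1 / (m + 1)) < 1 := by
        rw [mul_one_div, div_lt_one (by positivity)]; linarith
      nlinarith
    have hz : ∀ i, f (v i) = 0 := fun i => (Finset.sum_eq_zero_iff_of_nonneg fun j _ => h0 j).1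
      (le_antisymm hsum (Finset.sum_nonneg fun j _ => h0 j)) i (Finset.mem_univ i)
    intro w hw
    rw [← hvW] at hw
    refine (Submodule.span_le (p := LinearMap.ker f)).2 ?_ hw
    rintro _ ⟨i, rfl⟩
    exact hz i

/-- Near a recession direction `d`, finite generation modulo the tube span implies
finite generation. -/
theorem exists_finite_generators_near {Λ : AddSubgroup E}
    (hspan : Submodule.span ℝ (Λ : Set E) = ⊤) {d : E} {ε : ℝ} (hε : 0 < ε)
    (hst : ∀ δ, 0 < δ → δ ≤ ε → tubeSpan Λ d δ = tubeSpan Λ d ε)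
    {D : Set E} (hεD : Metric.ball 0 ε ⊆ D)
    (hrec : ∀ u ∈ D, ∀ t : ℝ, 0 ≤ t → u + t • d ∈ D)
    {S₁ : Set E} (hS₁ : S₁.Finite) (hS₁D : S₁ ⊆ D ∩ Λ)
    (hgen : ∀ a ∈ D ∩ Λ, ∃ s ∈ PointedCone.hull ℝ S₁, a - s ∈ tubeSpan Λ d ε) :
    ∃ S : Set E, S.Finite ∧ S ⊆ D ∩ Λ ∧ ∃ U ∈ nhds d, ∀ a ∈ D ∩ Λ, ∀ r : ℝ, 0 < r →
      r • a ∈ U → a ∈ PointedCone.hull ℝ S := by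
  obtain ⟨S₂, hS₂, hS₂t, hpos⟩ := exists_finite_positive_span hspan hε hst
  have hd := mem_tubeSpan hspan d hε
  obtain ⟨G, hG, hull⟩ := exists_finite_dual_halfspaces (hS₁.union hS₂)
  have hG0 : ∀ f ∈ G, ∀ s ∈ S₁ ∪ S₂, 0 ≤ f s := fun f hf s hs =>
    (hull s).1 (Submodule.subset_span hs) f hf
  refine ⟨S₁ ∪ S₂, hS₁.union hS₂, union_subset hS₁D fun s hs =>
    ⟨tube_subset hεD hrec (hS₂t hs), (hS₂t hs).1⟩, ⋂ f ∈ {f ∈ G | 0 < f d}, {x | 0 < f x}, ?_, ?_⟩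
  · refine (Filter.biInter_mem (hG.subset (sep_subset _ _))).2 fun f hf => ?_
    exact (isOpen_lt continuous_const (LinearMap.continuous_of_finiteDimensional f)).mem_nhds hf.2
  · intro a ha r hr hra
    rw [hull]
    intro f hf
    -- A facet form positive at `d` is positive on `U`. Any other one vanishes on the tube span, so
    -- its value at `a` is its value at a point of `hull S₁`.
    rcases lt_or_ge 0 (f d) with hfd | hfd
    · have : 0 < f (r • a) := mem_iInter₂.1 hra f ⟨hf, hfd⟩
      rw [map_smul, smul_eq_mul] at this
      exact (pos_of_mul_pos_right this hr.le).le
    · obtain ⟨s, hs, has⟩ := hgen a ha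
      have h1 := hpos f (fun s hs => hG0 f hf s (Or.inr hs)) hfd _ has
      have h2 : 0 ≤ f s := (hull s).1 (Submodule.span_mono subset_union_left hs) f hf
      rw [map_sub] at h1
      linarith

/-- Discreteness survives the quotient because the subspace is spanned by points of `Λ`: subtracting
integral parts of coefficients gives every class of norm at most `R` a bounded representative in
`Λ`. -/
theorem finite_map_mkQ_of_le {Λ : AddSubgroup E} (hfin : ∀ R : ℝ, {l ∈ (Λ : Set E) | ‖l‖ ≤ R}.Finite)
    {T : Set E} (hT : T ⊆ Λ) (R : ℝ) :
    {y ∈ (Λ.map (Submodule.span ℝ T).mkQ.toAddMonoidHom : Set (E ⧸ Submodule.span ℝ T)) |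
      ‖y‖ ≤ R}.Finite := by
  obtain ⟨v, hv, hvs, -⟩ := Submodule.exists_fun_fin_finrank_span_eq ℝ T
  refine ((hfin (R + 1 + ∑ i, ‖v i‖)).image (Submodule.span ℝ T).mkQ).subset ?_
  rintro _ ⟨⟨l, hl, rfl⟩, hle⟩
  obtain ⟨x, hx, hxn⟩ := Submodule.Quotient.norm_mk_lt ((Submodule.span ℝ T).mkQ l) one_pos
  have hxl : l - x ∈ Submodule.span ℝ T := by
    rw [← Submodule.Quotient.eq]; exact hx.symm
  rw [← hvs] at hxl
  obtain ⟨c, hc⟩ := (Submodule.mem_span_range_iff_exists_fun ℝ).1 hxl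
  refine ⟨l - ∑ i, ⌊c i⌋ • v i, ⟨Λ.sub_mem hl (Λ.sum_mem fun i _ => Λ.zsmul_mem (hT (hv i)) _), ?_⟩,
    ?_⟩
  · have h1 : l - ∑ i, ⌊c i⌋ • v i = x + ∑ i, Int.fract (c i) • v i := by
      have h2 : ∑ i, Int.fract (c i) • v i = (l - x) - ∑ i, ⌊c i⌋ • v i := by
        rw [← hc, ← Finset.sum_sub_distrib]
        refine Finset.sum_congr rfl fun i _ => ?_
        rw [← Int.cast_smul_eq_zsmul ℝ, ← sub_smul, Int.self_sub_floor]
      rw [h2]; abel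
    rw [h1]
    refine (norm_add_le _ _).trans (add_le_add ?_ ((norm_sum_le _ _).trans
      (Finset.sum_le_sum fun i _ => ?_)))
    · have : ‖(Submodule.span ℝ T).mkQ l‖ ≤ R := hle
      linarith
    · rw [norm_smul, Real.norm_of_nonneg (Int.fract_nonneg _)]
      exact mul_le_of_le_one_left (norm_nonneg _) (Int.fract_lt_one _).le
  · refine (Submodule.Quotient.eq _).2 ?_
    rw [sub_sub_cancel_left]
    exact Submodule.neg_mem _ (Submodule.sum_mem _ fun i _ =>
      zsmul_mem (Submodule.subset_span (hv i)) _)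

end Tube

/-- The lattice points of an open convex set that contains `0` generate a finitely generated
cone. -/
theorem exists_finite_generators {E : Type*} [NormedAddCommGroup E] [NormedSpace ℝ E]
    [FiniteDimensional ℝ E] (Λ : AddSubgroup E)
    (hfin : ∀ R : ℝ, {l ∈ (Λ : Set E) | ‖l‖ ≤ R}.Finite)
    (hspan : Submodule.span ℝ (Λ : Set E) = ⊤)
    {D : Set E} (hD : IsOpen D) (hconv : Convex ℝ D) (h0 : (0 : E) ∈ D) :
    ∃ S : Set E, S.Finite ∧ S ⊆ D ∩ Λ ∧ D ∩ Λ ⊆ PointedCone.hull ℝ S := by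
  induction hn : Module.finrank ℝ E using Nat.strong_induction_on generalizing E with
  | _ n ih =>
    have hcpt : IsCompact (Metric.sphere (0 : E) 1) := isCompact_sphere _ _
    have key : ∃ S : Set E, S.Finite ∧ S ⊆ D ∩ Λ ∧ ∀ a ∈ D ∩ Λ,
        ‖a‖⁻¹ • a ∈ Metric.sphere (0 : E) 1 → a ∈ PointedCone.hull ℝ S := by
      refine hcpt.induction_on (p := fun s => ∃ S : Set E, S.Finite ∧ S ⊆ D ∩ Λ ∧ ∀ a ∈ D ∩ Λ,
        ‖a‖⁻¹ • a ∈ s → a ∈ PointedCone.hull ℝ S) ⟨∅, finite_empty, empty_subset _, by simp⟩ ?_ ?_ ?_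
      · rintro s t hst ⟨S, hS, hSD, h⟩
        exact ⟨S, hS, hSD, fun a ha hs => h a ha (hst hs)⟩
      · rintro s t ⟨S, hS, hSD, h⟩ ⟨S', hS', hSD', h'⟩
        refine ⟨S ∪ S', hS.union hS', union_subset hSD hSD', ?_⟩
        rintro a ha (hs | hs)
        · exact Submodule.span_mono subset_union_left (h a ha hs)
        · exact Submodule.span_mono subset_union_right (h' a ha hs)
      · intro d hd
        -- Either `D` has arbitrarily distant points in directions near `d`, and `d` is a recession
        -- direction, or the points of `D` in directions near `d` are bounded and finitely many
        -- lattice points remain.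
        by_cases hrec : ∀ U ∈ nhds d, ∀ R : ℝ, ∃ a ∈ D, R < ‖a‖ ∧ ‖a‖⁻¹ • a ∈ U
        · replace hrec := add_smul_mem_of_unbounded hD hconv hrec
          obtain ⟨ε₀, hε₀, hball⟩ := Metric.isOpen_iff.1 hD 0 h0
          obtain ⟨ε, hε, hεε₀, hst⟩ := exists_tubeSpan_stable Λ d hε₀
          have hεD := (Metric.ball_subset_ball hεε₀).trans hball
          set W := tubeSpan Λ d ε with hW
          have hTΛ : tube Λ d ε ⊆ Λ := fun l hl => hl.1
          have hdW := mem_tubeSpan hspan d hε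
          have hd0 : d ≠ 0 := fun h => by simp [h] at hd
          have hlt : Module.finrank ℝ (E ⧸ W) < n := by
            rw [← hn, ← W.finrank_quotient_add_finrank]
            have : 0 < Module.finrank ℝ W :=
              Module.finrank_pos_iff_exists_ne_zero.2 ⟨⟨d, hdW⟩, by simpa using hd0⟩
            omega
          have : IsClosed (W : Set E) := Submodule.closed_of_finiteDimensional _
          obtain ⟨S', hS', hS'D, hgen'⟩ := ih _ hlt (Λ.map W.mkQ.toAddMonoidHom)
            (finite_map_mkQ_of_le hfin hTΛ) (by
              have := Submodule.map_span W.mkQ (Λ : Set E)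
              rw [hspan, Submodule.map_top, Submodule.range_mkQ] at this
              exact this.symm)
            (D := W.mkQ '' D) (W.isOpenMap_mkQ _ hD) (hconv.linear_image _)
            ⟨0, h0, map_zero _⟩ rfl
          have hlift : ∀ y ∈ S', ∃ l, l ∈ D ∩ Λ ∧ W.mkQ l = y := fun y hy => by
            obtain ⟨⟨u, hu, rfl⟩, ⟨l, hl, hlu⟩⟩ := hS'D hy
            have hul : u - l ∈ W := (Submodule.Quotient.eq W).1 hlu.symm
            obtain ⟨l', hl', hl'D, hl'l⟩ :=
              exists_mem_of_mem_add_tubeSpan hε hst hD hrec hu hl hul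
            exact ⟨l', ⟨hl'D, hl'⟩, ((Submodule.Quotient.eq W).2 hl'l).trans hlu⟩
          choose! g hgD hg using hlift
          obtain ⟨S, hS, hSD, U, hU, hgen⟩ := exists_finite_generators_near hspan hε hst hεD hrec
            (hS'.image g) (image_subset_iff.2 hgD) (fun a ha => by
              have hlift' : ∀ y ∈ PointedCone.hull ℝ S', ∃ s ∈ PointedCone.hull ℝ (g '' S'),
                  W.mkQ s = y := fun y hy => by
                refine hull_induction (p := fun y => ∃ s ∈ PointedCone.hull ℝ (g '' S'),
                  W.mkQ s = y) ?_ ?_ ?_ ?_ hy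
                · exact fun y hy => ⟨g y, Submodule.subset_span (mem_image_of_mem _ hy), hg y hy⟩
                · exact ⟨0, zero_mem _, map_zero _⟩
                · rintro _ _ ⟨s, hs, rfl⟩ ⟨s', hs', rfl⟩
                  exact ⟨s + s', add_mem hs hs', map_add _ _ _⟩
                · rintro t _ ht ⟨s, hs, rfl⟩
                  exact ⟨t • s, PointedCone.smul_mem _ ht hs, map_smul _ _ _⟩
              obtain ⟨s, hs, hsa⟩ := hlift' (W.mkQ a)
                (hgen' ⟨mem_image_of_mem _ ha.1, a, ha.2, rfl⟩)
              exact ⟨s, hs, (Submodule.Quotient.eq W).1 hsa.symm⟩)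
          refine ⟨U, mem_nhdsWithin_of_mem_nhds hU, S, hS, hSD, fun a ha haU => ?_⟩
          rcases eq_or_ne a 0 with rfl | ha0
          · exact zero_mem _
          · exact hgen a ha _ (inv_pos.2 (norm_pos_iff.2 ha0)) haU
        · push Not at hrec
          obtain ⟨U, hU, R, hR⟩ := hrec
          refine ⟨U, mem_nhdsWithin_of_mem_nhds hU, D ∩ {l ∈ (Λ : Set E) | ‖l‖ ≤ R},
            (hfin R).subset inter_subset_right, fun a ha => ⟨ha.1, ha.2.1⟩, fun a ha haU => ?_⟩
          refine Submodule.subset_span ⟨ha.1, ha.2, ?_⟩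
          by_contra! hlt
          exact hR a ha.1 hlt haU
    obtain ⟨S, hS, hSD, h⟩ := key
    refine ⟨S, hS, hSD, fun a ha => ?_⟩
    rcases eq_or_ne a 0 with rfl | ha0
    · exact zero_mem _
    · refine h a ha ?_
      rw [mem_sphere_zero_iff_norm, norm_smul, norm_inv, norm_norm,
        inv_mul_cancel₀ (norm_ne_zero_iff.2 ha0)]

/-! ### Relative interiors -/

section IntrinsicInterior

variable {E : Type*} [NormedAddCommGroup E] [NormedSpace ℝ E]

/-- A segment that ends in the relative interior can be prolonged. -/
theorem exists_add_smul_sub_mem {s : Set E} {p y : E} (hp : p ∈ intrinsicInterior ℝ s)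
    (hy : y ∈ s) : ∃ ε : ℝ, 0 < ε ∧ p + ε • (p - y) ∈ s := by
  obtain ⟨q, hq, rfl⟩ := mem_intrinsicInterior.1 hp
  have hmem : ∀ t : ℝ, (q : E) + t • ((q : E) - y) ∈ affineSpan ℝ s := fun t => by
    have := AffineSubspace.vadd_mem_of_mem_direction ((affineSpan ℝ s).direction.smul_mem t
      (AffineSubspace.vsub_mem_direction q.2 (subset_affineSpan ℝ s hy))) q.2
    rwa [vadd_eq_add, vsub_eq_sub, add_comm] at this
  let φ : ℝ → affineSpan ℝ s := fun t => ⟨(q : E) + t • ((q : E) - y), hmem t⟩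
  have hφ : Continuous φ := Continuous.subtype_mk (by fun_prop) _
  have h0 : φ 0 = q := Subtype.ext (by simp [φ])
  have hev : ∀ᶠ t in nhds (0 : ℝ), φ t ∈ ((↑) ⁻¹' s : Set (affineSpan ℝ s)) :=
    hφ.continuousAt.preimage_mem_nhds (by rw [h0]; exact mem_interior_iff_mem_nhds.1 hq)
  obtain ⟨ε, hε, hmem⟩ := ((hev.filter_mono nhdsWithin_le_nhds).and
    (self_mem_nhdsWithin (a := (0 : ℝ)) (s := Ioi 0))).exists
  exact ⟨ε, hmem, hε⟩

theorem mem_intrinsicInterior_of_eventually {s : Set E} {x : E} (hx : x ∈ s)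
    (h : ∀ᶠ y in nhds x, y ∈ affineSpan ℝ s → y ∈ s) : x ∈ intrinsicInterior ℝ s := by
  refine mem_intrinsicInterior.2 ⟨⟨x, subset_affineSpan ℝ s hx⟩, ?_, rfl⟩
  rw [mem_interior_iff_mem_nhds, mem_nhds_subtype]
  exact ⟨_, h, fun y hy => hy y.2⟩

theorem mem_openSegment_prolong {p y : E} {ε : ℝ} (hε : 0 < ε) :
    p ∈ openSegment ℝ y (p + ε • (p - y)) := by
  refine ⟨ε / (1 + ε), 1 / (1 + ε), by positivity, by positivity, by field_simp; ring, ?_⟩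
  have h1 : (1 + ε) ≠ 0 := by positivity
  have h2 : (ε / (1 + ε)) • y + (1 / (1 + ε)) • (p + ε • (p - y)) = ((1 + ε) / (1 + ε)) • p := by
    module
  rw [h2, div_self h1, one_smul]

end IntrinsicInterior

/-! ### Faces and their dual cones -/

section Faces

variable {V : Type*} [NormedAddCommGroup V] [NormedSpace ℝ V]

/-- The vectors for which every point of `P` minimizes the evaluation on `K`. -/
def minCone (K P : Set (StrongDual ℝ V)) : Set V :=
  {x : V | ∀ p ∈ P, IsMinOn (fun ξ : StrongDual ℝ V => ξ x) K p}

/-- The points of `K` where the evaluation at `x` is minimal. -/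
def minFace (K : Set (StrongDual ℝ V)) (x : V) : Set (StrongDual ℝ V) :=
  {ξ | ξ ∈ K ∧ ∀ η ∈ K, ξ x ≤ η x}

variable {K P Q : Set (StrongDual ℝ V)} {x y : V}

theorem mem_minCone : x ∈ minCone K P ↔ ∀ p ∈ P, ∀ η ∈ K, p x ≤ η x := Iff.rfl

theorem mem_minCone_iff_subset (hP : P ⊆ K) : x ∈ minCone K P ↔ P ⊆ minFace K x :=
  ⟨fun h _ hp => ⟨hP hp, h _ hp⟩, fun h _ hp => (h hp).2⟩

theorem zero_mem_minCone : (0 : V) ∈ minCone K P := mem_minCone.2 fun _ _ _ _ => by simp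

theorem add_mem_minCone (hx : x ∈ minCone K P) (hy : y ∈ minCone K P) : x + y ∈ minCone K P :=
  mem_minCone.2 fun _ hp _ hη => by
    rw [map_add, map_add]; exact add_le_add (hx _ hp hη) (hy _ hp hη)

theorem smul_mem_minCone {t : ℝ} (ht : 0 ≤ t) (hx : x ∈ minCone K P) : t • x ∈ minCone K P :=
  mem_minCone.2 fun p hp η hη => by
    rw [map_smul, map_smul]; exact mul_le_mul_of_nonneg_left (hx p hp hη) ht

theorem convex_minCone : Convex ℝ (minCone K P) := fun _ hx _ hy _ _ ha hb _ =>
  add_mem_minCone (smul_mem_minCone ha hx) (smul_mem_minCone hb hy)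

theorem isCone_minCone : IsCone (minCone K P) :=
  ⟨⟨0, zero_mem_minCone⟩, fun _ ht _ hx => smul_mem_minCone ht.le hx⟩

theorem minCone_anti (h : P ⊆ Q) : minCone K Q ⊆ minCone K P := fun _ hx _ hp => hx _ (h hp)

theorem isFace_minFace (hK : Convex ℝ K) (h : (minFace K x).Nonempty) : IsFace K (minFace K x) := by
  refine ⟨h, ?_, fun ξ hξ => hξ.1, ?_⟩
  · rintro ξ hξ η hη a b ha hb hab
    refine ⟨hK hξ.1 hη.1 ha hb hab, fun ζ hζ => ?_⟩
    have h1 := mul_le_mul_of_nonneg_left (hξ.2 ζ hζ) ha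
    have h2 := mul_le_mul_of_nonneg_left (hη.2 ζ hζ) hb
    change a * ξ x + b * η x ≤ ζ x
    have h3 : a * ζ x + b * ζ x = ζ x := by rw [← add_mul, hab, one_mul]
    linarith
  · rintro ξ hξ η hη _ hζ ⟨a, b, ha, hb, hab, rfl⟩
    refine ⟨hξ, fun θ hθ => ?_⟩
    have h1 := hζ.2 η hη
    have h2 := hζ.2 θ hθ
    change a * ξ x + b * η x ≤ _ at h1
    change a * ξ x + b * η x ≤ _ at h2
    have hb' : b = 1 - a := by linarith
    subst hb'
    have h3 : ξ x ≤ η x := by nlinarith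
    nlinarith

theorem apply_eq_zero_of_mem_vectorSpan (hPK : P ⊆ K) (hx : x ∈ minCone K P)
    {v : StrongDual ℝ V} (hv : v ∈ vectorSpan ℝ P) : v x = 0 := by
  induction hv using Submodule.span_induction with
  | mem v hv =>
    obtain ⟨p, hp, q, hq, rfl⟩ := hv
    have h1 : p x ≤ q x := hx p hp (hPK hq)
    have h2 : q x ≤ p x := hx q hq (hPK hp)
    simp [le_antisymm h1 h2]
  | zero => simp
  | add v w _ _ hv hw => simp [hv, hw]
  | smul a v _ hv => simp [hv]

/-- The set `F` generates the cone of `K` at the relatively interior point `p` of the face `P`. -/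
structure FaceGenerators (K P : Set (StrongDual ℝ V)) (p : StrongDual ℝ V)
    (F : Set (StrongDual ℝ V)) : Prop where
  finite : F.Finite
  mem : p ∈ P
  prolong : ∀ y ∈ P, ∃ ε : ℝ, 0 < ε ∧ p + ε • (p - y) ∈ P
  generates : ∀ ξ ∈ K, ξ - p ∈ PointedCone.hull ℝ F
  feasible : ∀ f ∈ F, ∃ ε : ℝ, 0 < ε ∧ p + ε • f ∈ K

namespace FaceGenerators

variable {p : StrongDual ℝ V} {F : Set (StrongDual ℝ V)}

/-- A linear function minimal at a relatively interior point of `P` cannot be larger at another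
point `y` of `P`, since it would decrease beyond `p` on the line from `y`. -/
theorem mem_minCone_iff_min (h : FaceGenerators K P p F) (hPK : P ⊆ K) :
    x ∈ minCone K P ↔ ∀ η ∈ K, p x ≤ η x := by
  refine ⟨fun hx => hx p h.mem, fun hx y hy η hη => ?_⟩
  obtain ⟨ε, hε, hm⟩ := h.prolong y hy
  have h1 := hx _ (hPK hm)
  change p x ≤ p x + ε * (p x - y x) at h1
  have h2 : y x ≤ p x := by nlinarith
  exact h2.trans (hx η hη)

theorem mem_minCone_iff (h : FaceGenerators K P p F) (hPK : P ⊆ K) :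
    x ∈ minCone K P ↔ ∀ f ∈ F, 0 ≤ f x := by
  rw [h.mem_minCone_iff_min hPK]
  constructor
  · intro hx f hf
    obtain ⟨ε, hε, hm⟩ := h.feasible f hf
    have h1 := hx _ hm
    change p x ≤ p x + ε * f x at h1
    by_contra! hlt
    nlinarith
  · intro hx η hη
    have := hull_induction (p := fun ξ : StrongDual ℝ V => 0 ≤ ξ x) hx (by simp)
      (fun ξ ζ h1 h2 => add_nonneg h1 h2) (fun t ξ ht h1 => mul_nonneg ht h1) (h.generates η hη)
    change 0 ≤ η x - p x at this
    linarith

theorem feasible_of_mem_hull (h : FaceGenerators K P p F) (hK : Convex ℝ K) (hp : p ∈ K)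
    {v : StrongDual ℝ V} (hv : v ∈ PointedCone.hull ℝ F) :
    ∃ ε : ℝ, 0 < ε ∧ p + ε • v ∈ K := by
  refine hull_induction (p := fun v => ∃ ε : ℝ, 0 < ε ∧ p + ε • v ∈ K) h.feasible
    ⟨1, one_pos, by simpa using hp⟩ ?_ ?_ hv
  · rintro v w ⟨ε, hε, hv⟩ ⟨δ, hδ, hw⟩
    -- The weights `δ / (ε + δ)` and `ε / (ε + δ)` give `v` and `w` the same coefficient.
    refine ⟨ε * δ / (ε + δ), by positivity, ?_⟩
    have := hK hv hw (a := δ / (ε + δ)) (b := ε / (ε + δ)) (by positivity) (by positivity)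
      (by field_simp; ring)
    convert this using 1
    have hs : δ / (ε + δ) + ε / (ε + δ) = 1 := by field_simp; ring
    have e1 : (δ / (ε + δ)) • (p + ε • v) + (ε / (ε + δ)) • (p + δ • w) =
      (δ / (ε + δ) + ε / (ε + δ)) • p + (ε * δ / (ε + δ)) • (v + w) := by
      module
    rw [e1, hs, one_smul]
  · rintro t v ht ⟨ε, hε, hv⟩
    rcases ht.eq_or_lt with rfl | ht
    · exact ⟨1, one_pos, by simpa using hp⟩
    · exact ⟨ε / t, by positivity, by rwa [smul_smul, div_mul_cancel₀ _ ht.ne']⟩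

/-- Faces are exposed: take for `x` the sum of finitely many vectors `X` that cut out `hull F`. At a
minimizer `ξ` every summand vanishes on `ξ - p`, so `p - ξ` is feasible as well. Then `p` is
interior to a segment of `K` starting at `ξ`, whence `ξ ∈ P`. -/
theorem exists_minFace_eq [FiniteDimensional ℝ V] (h : FaceGenerators K P p F) (hK : Convex ℝ K)
    (hP : IsFace K P) : ∃ x : V, minFace K x = P := by
  have hpK := hP.isExtreme.subset h.mem
  let b := Module.finBasis ℝ V
  obtain ⟨X, hX, -, hull⟩ := exists_finite_halfspaces
    (ContinuousLinearMap.coeLM ℝ : StrongDual ℝ V →ₗ[ℝ] V →ₗ[ℝ] ℝ) univ univ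
    (fun _ _ _ _ _ _ => mem_univ _) (range b ∪ range fun i => -b i)
    ((finite_range _).union (finite_range _)) (subset_univ _) (fun ξ hξ => by
      refine ContinuousLinearMap.coe_injective (b.ext fun i => ?_)
      have h1 := hξ _ (Or.inl ⟨i, rfl⟩)
      have h2 := hξ _ (Or.inr ⟨i, rfl⟩)
      simp only [ContinuousLinearMap.coeLM_apply, ContinuousLinearMap.coe_coe, map_neg] at h1 h2
      simp only [ContinuousLinearMap.coe_coe, _root_.zero_apply]
      linarith) h.finite (subset_univ _)
  replace hull : ∀ ξ : StrongDual ℝ V, ξ ∈ PointedCone.hull ℝ F ↔ ∀ x ∈ X, 0 ≤ ξ x := hull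
  have hsum : ∀ ξ : StrongDual ℝ V, ξ (∑ x ∈ hX.toFinset, x) = ∑ x ∈ hX.toFinset, ξ x :=
    fun ξ => map_sum _ _ _
  have hle : ∀ ξ ∈ K, p (∑ x ∈ hX.toFinset, x) ≤ ξ (∑ x ∈ hX.toFinset, x) := fun ξ hξ => by
    rw [hsum, hsum]
    refine Finset.sum_le_sum fun x hx => ?_
    have := (hull _).1 (h.generates ξ hξ) x (hX.mem_toFinset.1 hx)
    change 0 ≤ ξ x - p x at this
    linarith
  refine ⟨∑ x ∈ hX.toFinset, x, Subset.antisymm ?_ ?_⟩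
  · rintro ξ ⟨hξ, hmin⟩
    have hg := (hull _).1 (h.generates ξ hξ)
    have heq : ∑ x ∈ hX.toFinset, (ξ - p) x = 0 := by
      rw [← hsum]
      change ξ _ - p _ = 0
      linarith [hmin p hpK, hle ξ hξ]
    have hz := (Finset.sum_eq_zero_iff_of_nonneg fun x hx => hg x (hX.mem_toFinset.1 hx)).1 heq
    have hopp : p - ξ ∈ PointedCone.hull ℝ F := (hull _).2 fun x hx => by
      have := hz x (hX.mem_toFinset.2 hx)
      change ξ x - p x = 0 at this
      change 0 ≤ p x - ξ x
      linarith
    obtain ⟨ε, hε, hm⟩ := h.feasible_of_mem_hull hK hpK hopp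
    exact hP.isExtreme.left_mem_of_mem_openSegment hξ hm h.mem (mem_openSegment_prolong hε)
  · exact (mem_minCone_iff_subset hP.isExtreme.subset).1
      ((h.mem_minCone_iff_min hP.isExtreme.subset).2 hle)

theorem mem_vectorSpan (h : FaceGenerators K P p F) (hx : minFace K x = P)
    {f : StrongDual ℝ V} (hf : f ∈ F) (hfx : f x = 0) : f ∈ vectorSpan ℝ P := by
  obtain ⟨ε, hε, hm⟩ := h.feasible f hf
  have hpx : p ∈ minFace K x := hx ▸ h.mem
  have hmP : p + ε • f ∈ P := by
    rw [← hx]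
    refine ⟨hm, fun η hη => ?_⟩
    change p x + ε * f x ≤ η x
    rw [hfx, mul_zero, add_zero]
    exact hpx.2 η hη
  have := Submodule.smul_mem _ ε⁻¹ (vsub_mem_vectorSpan ℝ hmP h.mem)
  rwa [vsub_eq_sub, add_sub_cancel_left, inv_smul_smul₀ hε.ne'] at this

/-- At a vector `x` whose minimizers are exactly `P`, the generators vanishing at `x` are directions
of `P`. A vector killed by these directions is therefore a feasible displacement from `x`, the other
inequalities being strict. -/
theorem vectorSpan_minCone [FiniteDimensional ℝ V] (h : FaceGenerators K P p F) (hK : Convex ℝ K)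
    (hP : IsFace K P) : vectorSpan ℝ (minCone K P) = Submodule.dualCoannihilator
      ((vectorSpan ℝ P).map (ContinuousLinearMap.coeLM ℝ : _ →ₗ[ℝ] V →ₗ[ℝ] ℝ)) := by
  have hPK := hP.isExtreme.subset
  apply le_antisymm
  · refine Submodule.span_le.2 ?_
    rintro _ ⟨y, hy, z, hz, rfl⟩
    refine (Submodule.mem_dualCoannihilator _).2 ?_
    rintro _ ⟨v, hv, rfl⟩
    change v (y - z) = 0
    rw [map_sub, apply_eq_zero_of_mem_vectorSpan hPK hy hv,
      apply_eq_zero_of_mem_vectorSpan hPK hz hv, sub_zero]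
  · intro y hy
    have hy' : ∀ v ∈ vectorSpan ℝ P, v y = 0 := fun v hv =>
      (Submodule.mem_dualCoannihilator _).1 hy _ ⟨v, hv, rfl⟩
    obtain ⟨x, hx⟩ := h.exists_minFace_eq hK hP
    have hxP : x ∈ minCone K P := (mem_minCone_iff_subset hPK).2 hx.ge
    have hev : ∀ᶠ ε in nhds (0 : ℝ), ∀ f ∈ F, 0 ≤ f (x + ε • y) := by
      refine (Filter.eventually_all_finite h.finite).2 fun f hf => ?_
      rcases ((h.mem_minCone_iff hPK).1 hxP f hf).eq_or_lt with hz | hpos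
      · have hfy := hy' f (h.mem_vectorSpan hx hf hz.symm)
        exact Filter.Eventually.of_forall fun ε => by simp [hfy, ← hz]
      · have hc : ContinuousAt (fun ε : ℝ => f (x + ε • y)) 0 := by fun_prop
        exact (hc.eventually (lt_mem_nhds (by simpa using hpos))).mono fun ε hε => le_of_lt hε
    obtain ⟨ε, hε, hε0⟩ := ((hev.filter_mono nhdsWithin_le_nhds).and
      (self_mem_nhdsWithin (a := (0 : ℝ)) (s := Ioi 0))).exists
    have := Submodule.smul_mem _ ε⁻¹
      (vsub_mem_vectorSpan ℝ ((h.mem_minCone_iff hPK).2 hε) hxP)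
    rwa [vsub_eq_sub, add_sub_cancel_left, inv_smul_smul₀ (ne_of_gt hε0)] at this

theorem dim_minCone_add_dim [FiniteDimensional ℝ V] (h : FaceGenerators K P p F)
    (hK : Convex ℝ K) (hP : IsFace K P) : dim (minCone K P) + dim P = Module.finrank ℝ V := by
  have hinj : Function.Injective (ContinuousLinearMap.coeLM ℝ : StrongDual ℝ V →ₗ[ℝ] V →ₗ[ℝ] ℝ) :=
    ContinuousLinearMap.coe_injective
  have h1 := Subspace.finrank_add_finrank_dualCoannihilator_eq
    ((vectorSpan ℝ P).map (ContinuousLinearMap.coeLM ℝ : _ →ₗ[ℝ] V →ₗ[ℝ] ℝ))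
  rw [dim, dim, h.vectorSpan_minCone hK hP, ← h1, add_comm,
    (Submodule.equivMapOfInjective _ hinj (vectorSpan ℝ P)).finrank_eq]

/-- The relative interior of the cone of a face consists of the vectors that are minimal exactly on
that face. -/
theorem mem_intrinsicInterior_iff [FiniteDimensional ℝ V] (h : FaceGenerators K P p F)
    (hK : Convex ℝ K) (hP : IsFace K P) :
    x ∈ intrinsicInterior ℝ (minCone K P) ↔ minFace K x = P := by
  have hPK := hP.isExtreme.subset
  constructor
  · intro hx
    have hxP : x ∈ minCone K P := intrinsicInterior_subset hx
    refine Subset.antisymm (fun ξ hξ => ?_) ((mem_minCone_iff_subset hPK).1 hxP)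
    obtain ⟨x₀, hx₀⟩ := h.exists_minFace_eq hK hP
    have hx₀P : x₀ ∈ minCone K P := (mem_minCone_iff_subset hPK).2 hx₀.ge
    -- As `ξ` and `p` agree at `x`, the inequality `p ≤ ξ` beyond `x` forces `ξ x₀ ≤ p x₀`; so `ξ`
    -- minimizes `x₀` too.
    obtain ⟨ε, hε, hm⟩ := exists_add_smul_sub_mem hx hx₀P
    have h1 : p (x + ε • (x - x₀)) ≤ ξ (x + ε • (x - x₀)) := hm p h.mem hξ.1
    have h2 : p x₀ ≤ ξ x₀ := hx₀P p h.mem hξ.1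
    have h3 : p x ≤ ξ x := hxP p h.mem hξ.1
    have h4 := hξ.2 p (hPK h.mem)
    simp only [map_add, map_smul, map_sub, smul_eq_mul] at h1
    rw [← hx₀]
    refine ⟨hξ.1, fun η hη => ?_⟩
    have h5 : ξ x₀ ≤ p x₀ := by
      have : ε * ξ x₀ ≤ ε * p x₀ := by
        have : ξ x = p x := le_antisymm h4 h3
        rw [this] at h1
        linarith
      exact le_of_mul_le_mul_left this hε
    exact h5.trans (hx₀P p h.mem hη)
  · intro hx
    have hxP : x ∈ minCone K P := (mem_minCone_iff_subset hPK).2 hx.ge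
    refine mem_intrinsicInterior_of_eventually hxP ?_
    have hev : ∀ᶠ y in nhds x, ∀ f ∈ {f ∈ F | 0 < f x}, 0 < f y :=
      (Filter.eventually_all_finite (h.finite.subset (sep_subset _ _))).2 fun f hf =>
        f.continuous.continuousAt.eventually (lt_mem_nhds hf.2)
    refine hev.mono fun y hy hys => (h.mem_minCone_iff hPK).2 fun f hf => ?_
    rcases ((h.mem_minCone_iff hPK).1 hxP f hf).eq_or_lt with hz | hpos
    · have hd := AffineSubspace.vsub_mem_direction hys (subset_affineSpan ℝ _ hxP)
      rw [direction_affineSpan, h.vectorSpan_minCone hK hP] at hd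
      have : f (y - x) = 0 := (Submodule.mem_dualCoannihilator _).1 hd _
        ⟨f, h.mem_vectorSpan hx hf hz.symm, rfl⟩
      rw [map_sub] at this
      linarith
    · exact (hy f ⟨hf, hpos⟩).le

end FaceGenerators

theorem le_of_mem_convexHull {A : Set (StrongDual ℝ V)} {c : ℝ} (h : ∀ ξ ∈ A, c ≤ ξ x)
    {ξ : StrongDual ℝ V} (hξ : ξ ∈ convexHull ℝ A) : c ≤ ξ x := by
  have hconv : Convex ℝ {ξ : StrongDual ℝ V | c ≤ ξ x} := by
    intro ξ hξ η hη a b ha hb hab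
    have h1 := mul_le_mul_of_nonneg_left (show c ≤ ξ x from hξ) ha
    have h2 := mul_le_mul_of_nonneg_left (show c ≤ η x from hη) hb
    change c ≤ a * ξ x + b * η x
    have : c = a * c + b * c := by rw [← add_mul, hab, one_mul]
    linarith
  exact convexHull_min h hconv hξ

/-- Faces of the convex hull of a set, all of whose points generate finitely generated cones,
have finite generators. -/
theorem exists_faceGenerators [FiniteDimensional ℝ V] {A : Set (StrongDual ℝ V)}
    (hA : ∀ a ∈ A, ∃ S : Set (StrongDual ℝ V), S.Finite ∧ (∀ s ∈ S, a + s ∈ A) ∧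
      ∀ ξ ∈ A, ξ - a ∈ PointedCone.hull ℝ S) (hP : IsFace (convexHull ℝ A) P) :
    ∃ p F, FaceGenerators (convexHull ℝ A) P p F ∧ (∀ f ∈ F, ∃ a ∈ A, a + f ∈ A) ∧
      ∃ T ⊆ A, T.Nonempty ∧ ∀ x, x ∈ minCone (convexHull ℝ A) P ↔
        ∀ a ∈ T, ∀ ξ ∈ A, a x ≤ ξ x := by
  obtain ⟨p, hp⟩ := hP.nonempty.intrinsicInterior hP.convex
  have hpP := intrinsicInterior_subset hp
  have hpK := hP.isExtreme.subset hpP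
  obtain ⟨ι, _, w, z, hw, hw1, hz, hzp⟩ := mem_convexHull_iff_exists_fintype.1 hpK
  choose S hS hSA hSgen using fun i => hA (z i) (hz i)
  -- Only the points `z i` of positive weight contribute: moving such a `z i` along `f` moves `p`
  -- along `w i • f`, so its feasible directions are feasible at `p`.
  have hgen : FaceGenerators (convexHull ℝ A) P p (⋃ i ∈ {i | 0 < w i}, S i) := by
    refine ⟨(toFinite _).biUnion fun i _ => hS i, hpP,
      fun y hy => exists_add_smul_sub_mem hp hy, fun ξ hξ => ?_, fun f hf => ?_⟩
    · have hpre : A ⊆ {ξ | ξ - p ∈ PointedCone.hull ℝ (⋃ i ∈ {i | 0 < w i}, S i)} := by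
        intro ξ hξ
        have : ξ - p = ∑ i, w i • (ξ - z i) := by
          simp only [smul_sub, Finset.sum_sub_distrib, ← Finset.sum_smul, hw1, one_smul, hzp]
        rw [mem_ofPred_eq, this]
        refine sum_mem fun i _ => ?_
        rcases (hw i).eq_or_lt with h0 | hpos
        · rw [← h0, zero_smul]; exact zero_mem _
        · exact PointedCone.smul_mem _ hpos.le
            (Submodule.span_mono (subset_biUnion_of_mem (u := S) hpos) (hSgen i ξ hξ))
      refine convexHull_min hpre ?_ hξ
      intro ξ hξ η hη a b ha hb hab
      have : a • ξ + b • η - p = a • (ξ - p) + b • (η - p) := by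
        have : p = (a + b) • p := by rw [hab, one_smul]
        nth_rewrite 1 [this]
        module
      rw [mem_ofPred_eq, this]
      exact add_mem (PointedCone.smul_mem _ ha hξ) (PointedCone.smul_mem _ hb hη)
    · obtain ⟨i, hi, hf⟩ := mem_iUnion₂.1 hf
      refine ⟨w i, hi, ?_⟩
      classical
      refine mem_convexHull_of_exists_fintype w (Function.update z i (z i + f)) hw hw1 ?_ ?_
      · intro j
        rcases eq_or_ne j i with rfl | hj
        · simpa using hSA j f hf
        · simpa [hj] using hz j
      · have : ∀ j, w j • Function.update z i (z i + f) j =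
            w j • z j + if j = i then w i • f else 0 := fun j => by
          rcases eq_or_ne j i with rfl | hj
          · simp
          · simp [hj]
        simp only [this, Finset.sum_add_distrib, hzp, Finset.sum_ite_eq', Finset.mem_univ, if_true]
  refine ⟨p, _, hgen, fun f hf => ?_, z '' {i | 0 < w i}, image_subset_iff.2 fun i _ => hz i, ?_,
    fun x => ?_⟩
  · obtain ⟨i, -, hf⟩ := mem_iUnion₂.1 hf
    exact ⟨z i, hz i, hSA i f hf⟩
  · refine Nonempty.image _ ?_
    by_contra hne
    have : ∀ i, w i = 0 := fun i => le_antisymm (not_lt.1 fun hi => hne ⟨i, hi⟩) (hw i)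
    simp [this] at hw1
  · have hpx : p x = ∑ i, w i * z i x := by
      rw [← hzp, _root_.sum_apply]; rfl
    rw [hgen.mem_minCone_iff_min hP.isExtreme.subset]
    constructor
    · rintro hx _ ⟨i, hi, rfl⟩ ξ hξ
      have h0 : ∀ j, p x ≤ z j x := fun j => hx _ (subset_convexHull ℝ A (hz j))
      have h1 : ∑ j, w j * (z j x - p x) = 0 := by
        simp only [mul_sub, Finset.sum_sub_distrib, ← Finset.sum_mul, hw1, one_mul, hpx, sub_self]
      have h2 := (Finset.sum_eq_zero_iff_of_nonneg fun j _ =>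
        mul_nonneg (hw j) (sub_nonneg.2 (h0 j))).1 h1 i (Finset.mem_univ i)
      have h3 : z i x = p x := by
        rcases mul_eq_zero.1 h2 with h | h
        · exact absurd h (ne_of_gt hi)
        · linarith
      rw [h3]
      exact hx _ (subset_convexHull ℝ A hξ)
    · intro hx η hη
      refine le_of_mem_convexHull (fun ξ hξ => ?_) hη
      rw [hpx]
      calc ∑ i, w i * z i x ≤ ∑ i, w i * ξ x := Finset.sum_le_sum fun i _ => by
            rcases (hw i).eq_or_lt with h0 | hpos
            · simp [← h0]
            · exact mul_le_mul_of_nonneg_left (hx _ ⟨i, hpos, rfl⟩ ξ hξ) (hw i)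
        _ = ξ x := by rw [← Finset.sum_mul, hw1, one_mul]

end Faces

variable {V : Type*} [NormedAddCommGroup V] [NormedSpace ℝ V]

/-! ### The dual lattice -/

section DualLattice

/-- The dual lattice as an additive subgroup. -/
def dualLatticeSubgroup (L : Submodule ℤ V) : AddSubgroup (StrongDual ℝ V) where
  carrier := dualLattice L
  zero_mem' := fun _ _ => ⟨0, by simp⟩
  add_mem' := fun {ξ η} hξ hη x hx => by
    obtain ⟨m, hm⟩ := hξ x hx
    obtain ⟨n, hn⟩ := hη x hx
    exact ⟨m + n, by simp [hm, hn]⟩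
  neg_mem' := fun {ξ} hξ x hx => by
    obtain ⟨m, hm⟩ := hξ x hx
    exact ⟨-m, by simp [hm]⟩

variable [FiniteDimensional ℝ V] (L : Submodule ℤ V) [DiscreteTopology L] [IsZLattice ℝ L]

theorem exists_lattice_basis : ∃ b : Module.Basis (Fin (Module.finrank ℝ V)) ℝ V,
    (∀ i, b i ∈ L) ∧ ∀ x ∈ L, ∀ i, ∃ n : ℤ, b.repr x i = n := by
  have := ZLattice.module_free ℝ L
  have := ZLattice.module_finite ℝ L
  let b₀ := Module.Free.chooseBasis ℤ L
  let b := b₀.ofZLatticeBasis ℝ L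
  have hcard : Fintype.card (Module.Free.ChooseBasisIndex ℤ L) = Module.finrank ℝ V :=
    (Module.finrank_eq_card_basis b).symm
  let e := Fintype.equivFinOfCardEq hcard
  refine ⟨b.reindex e, fun i => ?_, fun x hx i => ?_⟩
  · rw [Module.Basis.reindex_apply, Module.Basis.ofZLatticeBasis_apply]
    exact (b₀ _).2
  · rw [Module.Basis.repr_reindex_apply]
    exact ⟨_, Module.Basis.ofZLatticeBasis_repr_apply ℝ L b₀ ⟨x, hx⟩ _⟩

theorem span_dualLattice : Submodule.span ℝ (dualLatticeSubgroup L : Set (StrongDual ℝ V)) = ⊤ := by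
  obtain ⟨b, -, hb⟩ := exists_lattice_basis L
  rw [eq_top_iff]
  intro ξ _
  have : ξ = ∑ i, ξ (b i) • LinearMap.toContinuousLinearMap (b.coord i) := by
    refine ContinuousLinearMap.coe_injective (b.ext fun j => ?_)
    simp [Finsupp.single_apply]
  rw [this]
  exact Submodule.sum_mem _ fun i _ => Submodule.smul_mem _ _
    (Submodule.subset_span fun x hx => hb x hx i)

theorem finite_dualLattice_bounded (R : ℝ) :
    {ξ ∈ (dualLatticeSubgroup L : Set (StrongDual ℝ V)) | ‖ξ‖ ≤ R}.Finite := by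
  obtain ⟨b, hb, -⟩ := exists_lattice_basis L
  have hfin : ∀ i, {r : ℝ | (∃ n : ℤ, r = n) ∧ |r| ≤ R * ‖b i‖}.Finite := fun i => by
    refine ((finite_Icc (-⌊R * ‖b i‖⌋) ⌊R * ‖b i‖⌋).image (fun n : ℤ => (n : ℝ))).subset ?_
    rintro _ ⟨⟨n, rfl⟩, hn⟩
    rw [abs_le] at hn
    refine ⟨n, ⟨?_, Int.le_floor.2 hn.2⟩, rfl⟩
    have : -n ≤ ⌊R * ‖b i‖⌋ := Int.le_floor.2 (by push_cast; linarith)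
    linarith
  refine Finite.of_finite_image (f := fun ξ i => ξ (b i)) ((Finite.pi hfin).subset ?_) ?_
  · rintro _ ⟨ξ, ⟨hξ, hle⟩, rfl⟩ i -
    exact ⟨hξ _ (hb i), (ξ.le_opNorm _).trans (mul_le_mul_of_nonneg_right hle (norm_nonneg _))⟩
  · intro ξ _ η _ h
    exact ContinuousLinearMap.coe_injective (b.ext fun i => congrFun h i)

end DualLattice

/-! ### The open dual cone -/

section OpenDual

variable {C : Set V}

theorem apply_nonneg_of_mem_openDual {ξ : StrongDual ℝ V} (hξ : ξ ∈ openDual C) {x : V}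
    (hx : x ∈ closure C) : 0 ≤ ξ x := by
  have h : C ⊆ {x | 0 ≤ ξ x} := interior_subset hξ
  exact closure_minimal h (isClosed_le continuous_const ξ.continuous) hx

theorem convex_dual (C : Set V) : Convex ℝ {ξ : StrongDual ℝ V | ∀ x ∈ C, 0 ≤ ξ x} :=
  fun _ hξ _ hη _ _ ha hb _ x hx =>
    add_nonneg (mul_nonneg ha (hξ x hx)) (mul_nonneg hb (hη x hx))

theorem convex_openDual (C : Set V) : Convex ℝ (openDual C) := (convex_dual C).interior

/-- The margin around `ξ` does not shrink along its ray, so the lattice points supplied by Dirichlet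
approximation land in the open dual. -/
theorem exists_ball_smul_subset_openDual {ξ : StrongDual ℝ V} (hξ : ξ ∈ openDual C) :
    ∃ r : ℝ, 0 < r ∧ ∀ t : ℝ, 1 ≤ t → ∀ μ, ‖μ - t • ξ‖ < r → μ ∈ openDual C := by
  obtain ⟨r, hr, hball⟩ := Metric.isOpen_iff.1 isOpen_interior ξ hξ
  refine ⟨r, hr, fun t ht μ hμ => ?_⟩
  have ht0 : 0 < t := by linarith
  suffices hsub : Metric.ball (t • ξ) r ⊆ {ξ : StrongDual ℝ V | ∀ x ∈ C, 0 ≤ ξ x} from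
    interior_maximal hsub Metric.isOpen_ball (by rwa [Metric.mem_ball, dist_eq_norm])
  intro η hη x hx
  have h1 : t⁻¹ • η ∈ Metric.ball ξ r := by
    rw [Metric.mem_ball, dist_eq_norm] at hη ⊢
    have : t⁻¹ • η - ξ = t⁻¹ • (η - t • ξ) := by rw [smul_sub, inv_smul_smul₀ ht0.ne']
    rw [this, norm_smul, norm_inv, Real.norm_of_nonneg ht0.le]
    calc t⁻¹ * ‖η - t • ξ‖ ≤ 1 * ‖η - t • ξ‖ :=
          mul_le_mul_of_nonneg_right (inv_le_one_of_one_le₀ ht) (norm_nonneg _)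
      _ < r := by rwa [one_mul]
  have h2 : 0 ≤ t⁻¹ * η x := interior_subset (hball h1) x hx
  exact nonneg_of_mul_nonneg_right h2 (inv_pos.2 ht0)

theorem add_smul_mem_openDual {f ξ : StrongDual ℝ V} (hf : ∀ x ∈ C, 0 ≤ f x) (hξ : ξ ∈ openDual C)
    {η : ℝ} (hη : 0 < η) : f + η • ξ ∈ openDual C := by
  let φ : StrongDual ℝ V → StrongDual ℝ V := fun ζ => η⁻¹ • (ζ - f)
  have hφ : Continuous φ := by fun_prop
  have hsub : φ ⁻¹' openDual C ⊆ {ξ : StrongDual ℝ V | ∀ x ∈ C, 0 ≤ ξ x} := by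
    intro ζ hζ x hx
    have hζ' : φ ζ ∈ openDual C := hζ
    have h1 : 0 ≤ η⁻¹ * (ζ x - f x) := interior_subset hζ' x hx
    have h2 := nonneg_of_mul_nonneg_right h1 (inv_pos.2 hη)
    linarith [hf x hx]
  refine interior_maximal hsub (isOpen_interior.preimage hφ) ?_
  simpa [φ, inv_smul_smul₀ hη.ne'] using hξ

theorem nonpos_of_bounded_above_on_cone (hC : IsCone C) {f : StrongDual ℝ V} {M : ℝ}
    (h : ∀ c ∈ C, f c ≤ M) {c : V} (hc : c ∈ C) : f c ≤ 0 := by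
  by_contra! hpos
  have h1 := h _ (hC.smul_mem ((|M| + 1) / f c) (by positivity) c hc)
  rw [map_smul, smul_eq_mul, div_mul_cancel₀ _ hpos.ne'] at h1
  linarith [le_abs_self M]

variable [FiniteDimensional ℝ V]

/-- Otherwise all forms nonnegative on `C` kill some `v ≠ 0`. Some `x + t • v` lies outside `C`, and
a form separating it from `C` is such a form up to sign, yet it cannot distinguish `x + t • v` from
`x ∈ C`. -/
theorem openDual_nonempty (hC_open : IsOpen C) (hC : IsCone C) (hconv : Convex ℝ C)
    (hnd : IsNondegenerate C) : (openDual C).Nonempty := by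
  have h0 : (0 : StrongDual ℝ V) ∈ {ξ : StrongDual ℝ V | ∀ x ∈ C, 0 ≤ ξ x} := fun x _ => le_rfl
  rw [openDual, (convex_dual C).interior_nonempty_iff_affineSpan_eq_top,
    AffineSubspace.affineSpan_eq_top_iff_vectorSpan_eq_top_of_nonempty _ _ _ ⟨0, h0⟩]
  by_contra hne
  obtain ⟨g, hg0, hg⟩ := Submodule.exists_le_ker_of_lt_top _ (lt_top_iff_ne_top.2 hne)
  obtain ⟨v, hv⟩ := (Module.evalEquiv ℝ V).surjective
    (g ∘ₗ (LinearMap.toContinuousLinearMap : (V →ₗ[ℝ] ℝ) ≃ₗ[ℝ] StrongDual ℝ V).toLinearMap)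
  have hgv : ∀ ξ : StrongDual ℝ V, g ξ = ξ v := fun ξ => by
    have h1 := LinearMap.congr_fun hv (ξ : V →ₗ[ℝ] ℝ)
    simp only [Module.evalEquiv_apply, Module.Dual.eval_apply, LinearMap.comp_apply,
      LinearEquiv.coe_coe] at h1
    exact h1.symm
  have hv0 : v ≠ 0 := by
    rintro rfl
    exact hg0 (LinearMap.ext fun ξ => by simp [hgv])
  obtain ⟨x, hx⟩ := hC.nonempty
  obtain ⟨t, ht⟩ := hnd x v hv0
  obtain ⟨f, hf⟩ := geometric_hahn_banach_open_point hconv hC_open ht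
  have hneg : ∀ c ∈ C, 0 ≤ (-f) c := fun c hc => by
    have := nonpos_of_bounded_above_on_cone hC (fun c hc => (hf c hc).le) hc
    change 0 ≤ -(f c)
    linarith
  have hfv : (-f) v = 0 := by
    rw [← hgv]
    have := vsub_mem_vectorSpan ℝ (s := {ξ : StrongDual ℝ V | ∀ x ∈ C, 0 ≤ ξ x}) hneg h0
    rw [vsub_eq_sub, sub_zero] at this
    exact hg this
  have h1 := hf x hx
  have h2 : f v = 0 := neg_eq_zero.1 hfv
  rw [map_add, map_smul, h2, smul_zero, add_zero] at h1
  exact lt_irrefl _ h1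

variable (L : Submodule ℤ V) [DiscreteTopology L] [IsZLattice ℝ L]

theorem openDual_inter_dualLattice_nonempty (h : (openDual C).Nonempty) :
    (openDual C ∩ dualLattice L).Nonempty := by
  obtain ⟨ξ, hξ⟩ := h
  obtain ⟨r, hr, hball⟩ := exists_ball_smul_subset_openDual hξ
  obtain ⟨μ, hμ, t, ht, hlt⟩ := exists_close_to_ray (span_dualLattice L) ξ hr 1
  exact ⟨μ, hball t ht μ hlt, hμ⟩

/-- If `x` is not in the closure, some `g` in the open dual is negative at `x`; lattice points near
the ray of `g` make the values at `x` unbounded below, so no minimum exists. -/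
theorem minCone_subset_closure (hC : IsCone C) (hconv : Convex ℝ C) (hne : (openDual C).Nonempty)
    {P : Set (StrongDual ℝ V)} (hP : P.Nonempty) :
    minCone (dualHull C L) P ⊆ closure C := by
  intro x hx
  by_contra hxC
  obtain ⟨f, u, hfu, hux⟩ := geometric_hahn_banach_closed_point hconv.closure isClosed_closure hxC
  have hf : ∀ c ∈ C, f c ≤ 0 := fun c hc =>
    nonpos_of_bounded_above_on_cone hC (fun c hc => (hfu c (subset_closure hc)).le) hc
  have hu : 0 ≤ u := by
    by_contra! hneg
    obtain ⟨c, hc⟩ := hC.nonempty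
    have h1 := hfu c (subset_closure hc)
    have hfc : f c < 0 := h1.trans hneg
    have h2 := hfu _ (subset_closure (hC.smul_mem (u / (2 * f c))
      (div_pos_of_neg_of_neg hneg (by linarith)) c hc))
    have h3 : u / (2 * f c) * f c = u / 2 := by
      have := hfc.ne
      field_simp
    rw [map_smul, smul_eq_mul, h3] at h2
    linarith
  obtain ⟨ξ, hξ⟩ := hne
  obtain ⟨p, hp⟩ := hP
  have hfx : 0 < f x := hu.trans_lt hux
  -- Small enough that `η * ξ x ≤ f x / 2`, so the perturbed form stays negative at `x`.
  set η : ℝ := f x / (2 * (|ξ x| + 1)) with hη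
  have hη0 : 0 < η := by positivity
  have hg := add_smul_mem_openDual (f := -f) (fun c hc => neg_nonneg.2 (hf c hc)) hξ hη0
  have hgx : (-f + η • ξ) x < 0 := by
    change -(f x) + η * ξ x < 0
    have h1 : η * ξ x ≤ η * (|ξ x| + 1) :=
      mul_le_mul_of_nonneg_left (by linarith [le_abs_self (ξ x)]) hη0.le
    have h2 : η * (|ξ x| + 1) = f x / 2 := by rw [hη]; field_simp
    linarith
  set g := -f + η • ξ
  obtain ⟨r, hr, hball⟩ := exists_ball_smul_subset_openDual hg
  -- The bound on `t` gives `r * ‖x‖ + t * g x ≤ p x - 1`, below the supposed minimum.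
  obtain ⟨μ, hμ, t, ht, hlt⟩ := exists_close_to_ray (span_dualLattice L) g hr
    (max 1 ((r * ‖x‖ - p x + 1) / (-g x)))
  have hμA : μ ∈ dualHull C L :=
    subset_convexHull ℝ _ ⟨hball t ((le_max_left _ _).trans ht) μ hlt, hμ⟩
  have h1 : p x ≤ μ x := hx p hp hμA
  have h2 : (μ - t • g) x ≤ r * ‖x‖ := (le_abs_self _).trans
    (((μ - t • g).le_opNorm x).trans (mul_le_mul_of_nonneg_right hlt.le (norm_nonneg _)))
  change μ x - t * g x ≤ _ at h2
  have h3 := (le_max_right _ _).trans ht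
  rw [div_le_iff₀ (neg_pos.2 hgx)] at h3
  linarith

theorem exists_generators_at_dualLattice_point (C : Set V) :
    ∀ a ∈ openDual C ∩ dualLattice L, ∃ S : Set (StrongDual ℝ V), S.Finite ∧
      (∀ s ∈ S, a + s ∈ openDual C ∩ dualLattice L) ∧
      ∀ ξ ∈ openDual C ∩ dualLattice L, ξ - a ∈ PointedCone.hull ℝ S := by
  rintro a ⟨ha, haL⟩
  obtain ⟨S, hS, hSD, hgen⟩ := exists_finite_generators (dualLatticeSubgroup L)
    (finite_dualLattice_bounded L) (span_dualLattice L) (D := (fun v => a + v) ⁻¹' openDual C)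
    (isOpen_interior.preimage (by fun_prop)) ((convex_openDual C).translate_preimage_right a)
    (by simpa using ha)
  refine ⟨S, hS, fun s hs => ⟨(hSD hs).1, (dualLatticeSubgroup L).add_mem haL (hSD hs).2⟩,
    fun ξ hξ => hgen ⟨?_, (dualLatticeSubgroup L).sub_mem hξ.2 haL⟩⟩
  simpa using hξ.1

end OpenDual

/-! ### Rational forms and rationally polyhedral cones -/

section Rational

variable {VQ : AddSubgroup V}

theorem IsRationalStructure.smul_mem (h : IsRationalStructure VQ) (q : ℚ) {x : V} (hx : x ∈ VQ) :
    (q : ℝ) • x ∈ VQ := by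
  obtain ⟨b, hb⟩ := h
  rw [hb] at hx ⊢
  intro i
  obtain ⟨r, hr⟩ := hx i
  exact ⟨q * r, by simp [hr]⟩

/-- A lattice basis has rational coordinates, and its matrix is invertible over `ℚ`; so `x` is a
rational combination of the basis, and clearing denominators suffices. -/
theorem IsRationalStructure.exists_nsmul_mem [FiniteDimensional ℝ V] (h : IsRationalStructure VQ)
    (L : Submodule ℤ V) [DiscreteTopology L] [IsZLattice ℝ L] (hL : ∀ x ∈ L, x ∈ VQ)
    {x : V} (hx : x ∈ VQ) : ∃ N : ℕ, 0 < N ∧ (N : ℝ) • x ∈ L := by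
  obtain ⟨b, hb⟩ := h
  obtain ⟨l, hl, -⟩ := exists_lattice_basis L
  choose r hr using fun i => (hb _).1 (hL _ (hl i))
  choose c hc using (hb x).1 hx
  let φ := Fintype.linearCombination ℚ r
  have hφ : ∀ q : Fin (Module.finrank ℝ V) → ℚ, ∀ j,
      ((φ q j : ℚ) : ℝ) = b.repr (∑ i, (q i : ℝ) • l i) j := fun q j => by
    simp [φ, Fintype.linearCombination_apply, hr, Finsupp.finsetSum_apply]
  have hinj : Function.Injective φ := by
    rw [injective_iff_map_eq_zero]
    intro q hq
    have h0 : ∑ i, (q i : ℝ) • l i = 0 := by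
      refine b.ext_elem fun j => ?_
      rw [← hφ, hq]; simp
    have := Fintype.linearIndependent_iff.1 l.linearIndependent (fun i => (q i : ℝ)) h0
    funext i
    exact_mod_cast this i
  obtain ⟨q, hq⟩ := LinearMap.injective_iff_surjective.1 hinj c
  have hx' : x = ∑ i, (q i : ℝ) • l i := by
    refine b.ext_elem fun j => ?_
    rw [← hφ, hq, hc]
  refine ⟨∏ i, (q i).den, Finset.prod_pos fun i _ => (q i).pos, ?_⟩
  rw [hx', Finset.smul_sum]
  refine sum_mem fun i _ => ?_
  obtain ⟨k, hk⟩ := Finset.dvd_prod_of_mem (fun i => (q i).den) (Finset.mem_univ i)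
  have : ((∏ i, (q i).den : ℕ) : ℝ) • (q i : ℝ) • l i = ((k : ℤ) * (q i).num) • l i := by
    rw [hk, smul_smul, ← Int.cast_smul_eq_zsmul ℝ]
    congr 1
    have h1 : ((q i).den : ℝ) ≠ 0 := by exact_mod_cast (q i).den_nz
    have h2 : (q i : ℝ) = (q i).num / (q i).den := by exact_mod_cast (Rat.num_div_den (q i)).symm
    rw [h2]
    push_cast
    field_simp
  rw [this]
  exact L.smul_mem _ (hl i)

theorem isRationalForm_of_mem_dualLattice [FiniteDimensional ℝ V] (h : IsRationalStructure VQ)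
    (L : Submodule ℤ V) [DiscreteTopology L] [IsZLattice ℝ L] (hL : ∀ x ∈ L, x ∈ VQ)
    {ξ : StrongDual ℝ V} (hξ : ξ ∈ dualLattice L) : IsRationalForm VQ ξ := by
  intro x hx
  obtain ⟨N, hN, hNx⟩ := h.exists_nsmul_mem L hL hx
  obtain ⟨n, hn⟩ := hξ _ hNx
  refine ⟨n / N, ?_⟩
  have hN' : (N : ℝ) ≠ 0 := by exact_mod_cast hN.ne'
  rw [map_smul, smul_eq_mul] at hn
  push_cast
  rw [← hn]
  field_simp

/-- Minkowski's theorem with rationality. -/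
theorem exists_rational_generators [FiniteDimensional ℝ V] (h : IsRationalStructure VQ)
    {F : Set (StrongDual ℝ V)} (hF : F.Finite) (hFQ : ∀ f ∈ F, IsRationalForm VQ f) :
    ∃ X : Set V, X.Finite ∧ X ⊆ VQ ∧ {x | ∀ f ∈ F, 0 ≤ f x} = PointedCone.hull ℝ X := by
  have h' := h
  obtain ⟨b, hb⟩ := h'
  have hbQ : ∀ i, b i ∈ VQ := fun i => (hb _).2 fun j => by
    rcases eq_or_ne i j with rfl | hij
    · exact ⟨1, by simp⟩
    · exact ⟨0, by simp [hij]⟩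
  obtain ⟨X, hX, hXQ, hull⟩ := exists_finite_halfspaces
    (ContinuousLinearMap.coeLM ℝ : StrongDual ℝ V →ₗ[ℝ] V →ₗ[ℝ] ℝ)
    {ξ | IsRationalForm VQ ξ} (VQ : Set V) (fun ξ hξ x hx y hy => by
      obtain ⟨q, hq⟩ := hξ x hx
      obtain ⟨r, hr⟩ := hξ y hy
      change ξ x • y - ξ y • x ∈ VQ
      rw [hq, hr]
      exact VQ.sub_mem (h.smul_mem q hy) (h.smul_mem r hx))
    (range b ∪ range fun i => -b i) ((finite_range _).union (finite_range _)) (by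
      rintro _ (⟨i, rfl⟩ | ⟨i, rfl⟩)
      exacts [hbQ i, VQ.neg_mem (hbQ i)]) (fun ξ hξ => by
      refine ContinuousLinearMap.coe_injective (b.ext fun i => ?_)
      have h1 := hξ _ (Or.inl ⟨i, rfl⟩)
      have h2 := hξ _ (Or.inr ⟨i, rfl⟩)
      simp only [ContinuousLinearMap.coeLM_apply, ContinuousLinearMap.coe_coe, map_neg] at h1 h2
      simp only [ContinuousLinearMap.coe_coe, _root_.zero_apply]
      linarith) hF hFQ
  replace hull : ∀ ξ : StrongDual ℝ V, ξ ∈ PointedCone.hull ℝ F ↔ ∀ x ∈ X, 0 ≤ ξ x := hull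
  refine ⟨X, hX, hXQ, Subset.antisymm (fun y hy => ?_) fun y hy => ?_⟩
  · obtain ⟨G, -, hG⟩ := exists_finite_dual_halfspaces hX
    rw [SetLike.mem_coe, hG]
    intro g hg
    -- Biduality: a form nonnegative on `X` lies in `hull F`, hence is nonnegative at `y`.
    have h1 : LinearMap.toContinuousLinearMap g ∈ PointedCone.hull ℝ F := (hull _).2 fun x hx =>
      (hG x).1 (Submodule.subset_span hx) g hg
    exact hull_induction (p := fun ξ : StrongDual ℝ V => 0 ≤ ξ y) hy (by simp)
      (fun ξ ζ h1 h2 => add_nonneg h1 h2) (fun t ξ ht h1 => mul_nonneg ht h1) h1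
  · intro f hf
    exact hull_induction (p := fun y => 0 ≤ f y)
      (fun x hx => (hull f).1 (Submodule.subset_span hf) x hx) (by simp)
      (fun x y h1 h2 => by rw [map_add]; exact add_nonneg h1 h2)
      (fun t x ht h1 => by rw [map_smul]; exact mul_nonneg ht h1) hy

theorem isRationalPolyhedron_of_finite {F : Set (StrongDual ℝ V)} (hF : F.Finite)
    (hFQ : ∀ f ∈ F, IsRationalForm VQ f) : IsRationalPolyhedron VQ {x | ∀ f ∈ F, 0 ≤ f x} := by
  classical
  refine ⟨hF.toFinset.image fun f => (f, 0), fun s hs => ?_, ?_⟩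
  · obtain ⟨f, hf, rfl⟩ := Finset.mem_image.1 hs
    exact hFQ f (hF.mem_toFinset.1 hf)
  · ext x
    simp

/-- A rationally polyhedral cone is defined by homogeneous inequalities. -/
theorem IsRatPolyCone.exists_homogeneous {K : Set V} (hK : IsRatPolyCone VQ K) :
    ∃ F : Set (StrongDual ℝ V), F.Finite ∧ (∀ f ∈ F, IsRationalForm VQ f) ∧
      K = {x | ∀ f ∈ F, 0 ≤ f x} := by
  obtain ⟨S, hS, hKS⟩ := hK.isRationalPolyhedron
  refine ⟨Prod.fst '' (S : Set (StrongDual ℝ V × ℚ)), S.finite_toSet.image _, ?_, ?_⟩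
  · rintro _ ⟨s, hs, rfl⟩
    exact hS s hs
  · have hform : ∀ x ∈ K, ∀ s ∈ S, 0 ≤ s.1 x := fun x hx s hs => by
      by_contra! hneg
      have h1 := hK.isCone.smul_mem ((|(s.2 : ℝ)| + 1) / -s.1 x)
        (div_pos (by positivity) (by linarith)) x hx
      rw [hKS] at h1
      have h2 := h1 s hs
      rw [map_smul, smul_eq_mul, div_neg, neg_mul, div_mul_cancel₀ _ hneg.ne] at h2
      linarith [le_abs_self (s.2 : ℝ)]
    have hconst : ∀ s ∈ S, 0 ≤ (s.2 : ℝ) := fun s hs => by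
      obtain ⟨x, hx⟩ := hK.isCone.nonempty
      by_contra! hneg
      have h0 := hform x hx s hs
      have h1 := hK.isCone.smul_mem (-(s.2 : ℝ) / (s.1 x + 1))
        (div_pos (by linarith) (by linarith)) x hx
      rw [hKS] at h1
      have h2 := h1 s hs
      have h3 : -(s.2 : ℝ) / (s.1 x + 1) * s.1 x < -s.2 := by
        rw [div_mul_eq_mul_div, div_lt_iff₀ (by linarith)]
        linarith
      rw [map_smul, smul_eq_mul] at h2
      linarith
    refine Subset.antisymm ?_ fun x hx => ?_
    · rintro x hx _ ⟨s, hs, rfl⟩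
      exact hform x hx s hs
    · rw [hKS]
      exact fun s hs => add_nonneg (hx _ ⟨s, hs, rfl⟩) (hconst s hs)

end Rational

/-! ### Minima on the rational hull -/

section RationalHull

variable {VQ : AddSubgroup V} {C : Set V}

theorem smul_mem_closure_of_isCone (hC : IsCone C) {t : ℝ} (ht : 0 < t) {x : V}
    (hx : x ∈ closure C) : t • x ∈ closure C :=
  map_mem_closure (continuous_const_smul t) hx fun c hc => hC.smul_mem t ht c hc

theorem zero_mem_closure_of_isCone (hC : IsCone C) : (0 : V) ∈ closure C := by
  obtain ⟨c, hc⟩ := hC.nonempty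
  have h1 : Filter.Tendsto (fun t : ℝ => t • c) (nhdsWithin 0 (Ioi 0)) (nhds 0) := by
    have : Continuous fun t : ℝ => t • c := by fun_prop
    simpa using (this.tendsto 0).mono_left nhdsWithin_le_nhds
  exact mem_closure_of_tendsto h1 (eventually_mem_nhdsWithin.mono fun t ht => hC.smul_mem t ht c hc)

/-- Real multiples of rational vectors need not be rational: multiply by the integer `⌈t⌉₊`, then
contract towards `0`. -/
theorem smul_mem_rationalHull (hC : IsCone C) {t : ℝ} (ht : 0 ≤ t) {x : V}
    (hx : x ∈ rationalHull VQ C) : t • x ∈ rationalHull VQ C := by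
  have hconv : Convex ℝ {x | t • x ∈ rationalHull VQ C} :=
    (convex_convexHull ℝ _).is_linear_preimage (IsLinearMap.isLinearMap_smul t)
  refine convexHull_min (t := {x | t • x ∈ rationalHull VQ C}) ?_ hconv hx
  rintro y ⟨hyC, hyQ⟩
  rcases ht.eq_or_lt with rfl | ht
  · rw [mem_ofPred_eq, zero_smul]
    exact subset_convexHull ℝ _ ⟨zero_mem_closure_of_isCone hC, VQ.zero_mem⟩
  have hn : (0 : ℝ) < ⌈t⌉₊ := by exact_mod_cast Nat.ceil_pos.2 ht
  have h0 : (0 : V) ∈ rationalHull VQ C :=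
    subset_convexHull ℝ _ ⟨zero_mem_closure_of_isCone hC, VQ.zero_mem⟩
  have h1 : (⌈t⌉₊ : ℝ) • y ∈ rationalHull VQ C := by
    refine subset_convexHull ℝ _ ⟨smul_mem_closure_of_isCone hC hn hyC, ?_⟩
    rw [Nat.cast_smul_eq_nsmul]
    exact VQ.nsmul_mem hyQ _
  have h2 := (convex_convexHull ℝ (closure C ∩ (VQ : Set V))).smul_mem_of_zero_mem h0 h1
    (t := t / ⌈t⌉₊) ⟨by positivity, (div_le_one hn).2 (Nat.le_ceil t)⟩
  rwa [smul_smul, div_mul_cancel₀ _ hn.ne'] at h2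

theorem hull_subset_rationalHull (hC : IsCone C) {X : Set V} (hX : X ⊆ closure C ∩ VQ) :
    (PointedCone.hull ℝ X : Set V) ⊆ rationalHull VQ C := by
  intro x hx
  refine hull_induction (p := fun x => x ∈ rationalHull VQ C)
    (fun x hx => subset_convexHull ℝ _ (hX hx))
    (subset_convexHull ℝ _ ⟨zero_mem_closure_of_isCone hC, VQ.zero_mem⟩) (fun x y hx hy => ?_)
    (fun t x ht hx => smul_mem_rationalHull hC ht hx) hx
  have := smul_mem_rationalHull hC zero_le_two (convex_convexHull ℝ _ hx hy
    (by norm_num : (0 : ℝ) ≤ 1 / 2) (by norm_num : (0 : ℝ) ≤ 1 / 2) (by norm_num))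
  rwa [← smul_add, smul_smul, mul_one_div_cancel two_ne_zero, one_smul] at this

theorem exists_finite_hull_of_mem_rationalHull {x : V} (hx : x ∈ rationalHull VQ C) :
    ∃ X : Set V, X.Finite ∧ X ⊆ closure C ∩ VQ ∧ x ∈ PointedCone.hull ℝ X := by
  obtain ⟨ι, _, w, z, hw, -, hz, rfl⟩ := mem_convexHull_iff_exists_fintype.1 hx
  exact ⟨range z, finite_range z, range_subset_iff.2 hz, sum_mem fun i _ =>
    PointedCone.smul_mem _ (hw i) (Submodule.subset_span (mem_range_self i))⟩

theorem rationalHull_subset_closure (hconv : Convex ℝ C) : rationalHull VQ C ⊆ closure C :=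
  convexHull_min inter_subset_left hconv.closure

theorem apply_le_of_mem_hull {X : Set V} {a b : StrongDual ℝ V} (h : ∀ x ∈ X, a x ≤ b x) {x : V}
    (hx : x ∈ PointedCone.hull ℝ X) : a x ≤ b x :=
  hull_induction (p := fun x => a x ≤ b x) h (by simp)
    (fun x y h1 h2 => by rw [map_add, map_add]; exact add_le_add h1 h2)
    (fun t x ht h1 => by rw [map_smul, map_smul]; exact mul_le_mul_of_nonneg_left h1 ht) hx

/-- Equality at a nonnegative combination forces equality at each generator that occurs with
positive coefficient. -/
theorem mem_hull_sep_of_apply_le {X : Set V} {a p : StrongDual ℝ V} (h : ∀ x ∈ X, a x ≤ p x) {x : V}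
    (hx : x ∈ PointedCone.hull ℝ X) (hle : p x ≤ a x) :
    x ∈ PointedCone.hull ℝ {x ∈ X | p x = a x} := by
  refine (hull_induction (p := fun x => a x ≤ p x ∧
    (p x ≤ a x → x ∈ PointedCone.hull ℝ {x ∈ X | p x = a x}))
    (fun x hx => ⟨h x hx, fun hle => Submodule.subset_span ⟨hx, hle.antisymm (h x hx)⟩⟩)
    ⟨by simp, fun _ => zero_mem _⟩ ?_ ?_ hx).2 hle
  · rintro x y ⟨hx, hx'⟩ ⟨hy, hy'⟩
    rw [map_add, map_add]
    exact ⟨add_le_add hx hy, fun hle => add_mem (hx' (by linarith)) (hy' (by linarith))⟩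
  · rintro t x ht ⟨hx, hx'⟩
    rw [map_smul, map_smul]
    refine ⟨mul_le_mul_of_nonneg_left hx ht, fun hle => ?_⟩
    rcases ht.eq_or_lt with rfl | ht
    · rw [zero_smul]; exact zero_mem _
    · exact PointedCone.smul_mem _ ht.le (hx' (le_of_mul_le_mul_left hle ht))

variable [FiniteDimensional ℝ V] (L : Submodule ℤ V) [DiscreteTopology L] [IsZLattice ℝ L]

/-- Dickson's lemma: finitely many points of `A` dominate all others on finitely many rational
vectors. -/
theorem exists_finite_minimal (h : IsRationalStructure VQ) (hL : ∀ x ∈ L, x ∈ VQ) {X : Set V}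
    (hX : X.Finite) (hXC : X ⊆ closure C ∩ VQ) :
    ∃ A₀ : Set (StrongDual ℝ V), A₀.Finite ∧ A₀ ⊆ openDual C ∩ dualLattice L ∧
      ∀ ξ ∈ openDual C ∩ dualLattice L, ∃ a ∈ A₀, ∀ x ∈ X, a x ≤ ξ x := by
  have := hX.to_subtype
  choose N hN hNL using fun x : X => h.exists_nsmul_mem L hL (hXC x.2).2
  -- The floor is exact on `C° ∩ L*`, where `N x * ξ x` is a nonnegative integer.
  let φ : StrongDual ℝ V → X → ℕ := fun ξ x => ⌊(N x : ℝ) * ξ x⌋₊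
  have hφ : ∀ ξ ∈ openDual C ∩ dualLattice L, ∀ x : X, (φ ξ x : ℝ) = N x * ξ x := fun ξ hξ x => by
    obtain ⟨n, hn⟩ := hξ.2 _ (hNL x)
    rw [map_smul, smul_eq_mul] at hn
    have h0 : 0 ≤ (N x : ℝ) * ξ x :=
      mul_nonneg (Nat.cast_nonneg _) (apply_nonneg_of_mem_openDual hξ.1 (hXC x.2).1)
    simp only [φ]
    rw [hn] at h0 ⊢
    obtain ⟨m, rfl⟩ := Int.eq_ofNat_of_zero_le (by exact_mod_cast h0 : 0 ≤ n)
    simp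
  set s := φ '' (openDual C ∩ dualLattice L) with hs
  have hfin : {m | Minimal (· ∈ s) m}.Finite :=
    WellQuasiOrderedLE.finite_of_isAntichain (setOfPred_minimal_antichain _)
  have hpre : ∀ m ∈ {m | Minimal (· ∈ s) m}, ∃ a ∈ openDual C ∩ dualLattice L, φ a = m :=
    fun m hm => hm.prop
  choose! g hgA hg using hpre
  refine ⟨g '' {m | Minimal (· ∈ s) m}, hfin.image g, image_subset_iff.2 hgA, fun ξ hξ => ?_⟩
  obtain ⟨m, hle, hm⟩ := (isPWO_of_wellQuasiOrderedLE s).exists_le_minimal (mem_image_of_mem φ hξ)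
  refine ⟨g m, mem_image_of_mem g hm, fun x hx => ?_⟩
  have h1 : ((φ (g m) ⟨x, hx⟩ : ℕ) : ℝ) ≤ φ ξ ⟨x, hx⟩ := by
    rw [hg m hm]
    exact_mod_cast hle ⟨x, hx⟩
  rw [hφ _ (hgA m hm), hφ _ hξ] at h1
  exact le_of_mul_le_mul_left h1 (by exact_mod_cast hN _)

theorem minFace_nonempty (h : IsRationalStructure VQ) (hL : ∀ x ∈ L, x ∈ VQ)
    (hA : (openDual C ∩ dualLattice L).Nonempty) {x : V} (hx : x ∈ rationalHull VQ C) :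
    (minFace (dualHull C L) x).Nonempty := by
  obtain ⟨X, hX, hXC, hxX⟩ := exists_finite_hull_of_mem_rationalHull hx
  obtain ⟨A₀, hA₀, hA₀A, hdom⟩ := exists_finite_minimal L h hL hX hXC
  obtain ⟨ξ₀, hξ₀⟩ := hA
  obtain ⟨a₀, ha₀, -⟩ := hdom ξ₀ hξ₀
  obtain ⟨a, ha, hmin⟩ := exists_min_image A₀ (fun a => a x) hA₀ ⟨a₀, ha₀⟩
  refine ⟨a, subset_convexHull ℝ _ (hA₀A ha), fun η hη => le_of_mem_convexHull (fun ξ hξ => ?_) hη⟩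
  obtain ⟨a', ha', hle⟩ := hdom ξ hξ
  exact (hmin a' ha').trans (apply_le_of_mem_hull hle hxX)

/-- On a cone generated by finitely many rational vectors of the closure of `C`, only finitely many
cones of minimality occur. -/
theorem finite_minimality_sets (h : IsRationalStructure VQ) (hL : ∀ x ∈ L, x ∈ VQ) {X : Set V}
    (hX : X.Finite) (hXC : X ⊆ closure C ∩ VQ) :
    {s : Set V | ∃ p ∈ openDual C ∩ dualLattice L,
      s = {x ∈ (PointedCone.hull ℝ X : Set V) | ∀ ξ ∈ openDual C ∩ dualLattice L,
        p x ≤ ξ x}}.Finite := by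
  obtain ⟨A₀, hA₀, hA₀A, hdom⟩ := exists_finite_minimal L h hL hX hXC
  -- The set for `p` is determined by a dominating `a ∈ A₀` and the set of `x ∈ X` where `p` and `a`
  -- agree: at a minimum `p` cannot exceed `a`.
  refine (hA₀.image2 (fun (a : StrongDual ℝ V) (I : Set V) =>
    {x ∈ (PointedCone.hull ℝ I : Set V) | ∀ a' ∈ A₀, a x ≤ a' x}) hX.powerset).subset ?_
  rintro _ ⟨p, hp, rfl⟩
  obtain ⟨a, ha, hap⟩ := hdom p hp
  refine ⟨a, ha, {x ∈ X | p x = a x}, sep_subset _ _, Subset.antisymm ?_ ?_⟩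
  · rintro x ⟨hx, hmin⟩
    have heq : p x = a x := by
      refine hull_induction (p := fun x => p x = a x) (fun x hx => hx.2) (by simp)
        (fun x y h1 h2 => by rw [map_add, map_add, h1, h2])
        (fun t x _ h1 => by rw [map_smul, map_smul, h1]) hx
    have hxX : x ∈ PointedCone.hull ℝ X := Submodule.span_mono (sep_subset _ _) hx
    refine ⟨hxX, fun ξ hξ => ?_⟩
    obtain ⟨a', ha', hle⟩ := hdom ξ hξ
    rw [heq]
    exact (hmin a' ha').trans (apply_le_of_mem_hull hle hxX)
  · rintro x ⟨hx, hmin⟩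
    have hpa := hmin a (hA₀A ha)
    exact ⟨mem_hull_sep_of_apply_le hap hx hpa, fun a' ha' =>
      (apply_le_of_mem_hull hap hx).trans (hmin a' (hA₀A ha'))⟩

end RationalHull

/-! ### Intersections and faces of the cones -/

section Decomposition

variable {K P : Set (StrongDual ℝ V)}

/-- Every nonempty subset is contained in a smallest face, on the level of minimality cones. -/
theorem exists_face_minCone_eq (hK : Convex ℝ K) {U : Set (StrongDual ℝ V)} (hU : U.Nonempty)
    (hUK : U ⊆ K) : ∃ Q, IsFace K Q ∧ minCone K U = minCone K Q := by
  have hface : IsFace K K := ⟨hU.mono hUK, hK, IsExtreme.refl ℝ K⟩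
  have hUQ : U ⊆ ⋂₀ {G | IsFace K G ∧ U ⊆ G} := subset_sInter fun G hG => hG.2
  have hQ : IsFace K (⋂₀ {G | IsFace K G ∧ U ⊆ G}) :=
    ⟨hU.mono hUQ, convex_sInter fun G hG => hG.1.convex,
      sInter_subset_of_mem ⟨hface, hUK⟩, fun x hx y hy z hz hzxy G hG =>
        hG.1.isExtreme.left_mem_of_mem_openSegment hx hy (hz G hG) hzxy⟩
  refine ⟨_, hQ, Subset.antisymm (fun x hx => ?_) (minCone_anti hUQ)⟩
  have hUx := (mem_minCone_iff_subset hUK).1 hx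
  exact (mem_minCone_iff_subset hQ.isExtreme.subset).2
    (sInter_subset_of_mem ⟨isFace_minFace hK (hU.mono hUx), hUx⟩)

/-- A face of a minimality cone is the minimality cone of the face on which one of its relatively
interior points is minimal. -/
theorem eq_minCone_of_isFace {s : Set V} (hP : P.Nonempty) (hPK : P ⊆ K)
    (hs : IsFace (minCone K P) s) {x : V} (hx : x ∈ intrinsicInterior ℝ s)
    (hxint : x ∈ intrinsicInterior ℝ (minCone K (minFace K x))) :
    s = minCone K (minFace K x) := by
  have hxs := intrinsicInterior_subset hx
  have hPx : P ⊆ minFace K x := (mem_minCone_iff_subset hPK).1 (hs.isExtreme.subset hxs)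
  apply Subset.antisymm
  · intro y hy q hq η hη
    -- Since `p` and `q` agree at `x`, the inequality `p ≤ q` beyond `x` yields `q y ≤ p y`.
    obtain ⟨ε, hε, hm⟩ := exists_add_smul_sub_mem hx hy
    obtain ⟨p, hp⟩ := hP
    have h1 : p (x + ε • (x - y)) ≤ q (x + ε • (x - y)) := hs.isExtreme.subset hm p hp hq.1
    have h2 : p x = q x := le_antisymm ((hPx hp).2 q hq.1) (hq.2 p (hPK hp))
    simp only [map_add, map_smul, map_sub, smul_eq_mul, h2] at h1
    have h3 : q y ≤ p y := le_of_mul_le_mul_left (a := ε) (by linarith) hε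
    exact h3.trans (hs.isExtreme.subset hy p hp hη)
  · intro y hy
    obtain ⟨ε, hε, hm⟩ := exists_add_smul_sub_mem hxint hy
    exact hs.isExtreme.left_mem_of_mem_openSegment (minCone_anti hPx hy) (minCone_anti hPx hm)
      hxs (mem_openSegment_prolong hε)

end Decomposition

end RatCone

/-! ### Assembly of the decomposition -/

theorem proposition3 {V : Type*} [NormedAddCommGroup V] [NormedSpace ℝ V]
    [FiniteDimensional ℝ V]
    (VQ : AddSubgroup V) (hVQ : RatCone.IsRationalStructure VQ)
    (C : Set V) (hC_open : IsOpen C) (hC_cone : RatCone.IsCone C) (hC_convex : Convex ℝ C)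
    (hC_nondeg : RatCone.IsNondegenerate C)
    (L : Submodule ℤ V) [DiscreteTopology L] [IsZLattice ℝ L] (hL : ∀ x ∈ L, x ∈ VQ) :
    (∀ P, RatCone.IsFace (RatCone.dualHull C L) P →
      RatCone.IsRatPolyCone VQ (RatCone.sigma C L P) ∧
      RatCone.dim (RatCone.sigma C L P) + RatCone.dim P = Module.finrank ℝ V) ∧
    Set.InjOn (RatCone.sigma C L) {P | RatCone.IsFace (RatCone.dualHull C L) P} ∧
    (∀ P Q, RatCone.IsFace (RatCone.dualHull C L) P → RatCone.IsFace (RatCone.dualHull C L) Q →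
      P ⊆ Q → RatCone.sigma C L Q ⊆ RatCone.sigma C L P) ∧
    RatCone.IsRatPolyDecomposition VQ (RatCone.rationalHull VQ C)
      (RatCone.sigmaCollection C L) := by
  open RatCone Set in
  have hK : Convex ℝ (dualHull C L) := convex_convexHull ℝ _
  have hne := openDual_nonempty hC_open hC_cone hC_convex hC_nondeg
  have hA := openDual_inter_dualLattice_nonempty L hne
  have hgen := fun P (hP : IsFace (dualHull C L) P) =>
    exists_faceGenerators (exists_generators_at_dualLattice_point L C) hP
  have hsigma : ∀ P, sigma C L P = minCone (dualHull C L) P := fun _ => rfl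
  have hpoly : ∀ P, IsFace (dualHull C L) P → ∃ F : Set (StrongDual ℝ V), F.Finite ∧
      (∀ f ∈ F, IsRationalForm VQ f) ∧ minCone (dualHull C L) P = {x | ∀ f ∈ F, 0 ≤ f x} := by
    intro P hP
    obtain ⟨p, F, hF, hFA, -⟩ := hgen P hP
    refine ⟨F, hF.finite, fun f hf => ?_, Set.ext fun x => hF.mem_minCone_iff hP.isExtreme.subset⟩
    obtain ⟨a, ha, haf⟩ := hFA f hf
    have := (dualLatticeSubgroup L).sub_mem haf.2 ha.2
    rw [add_sub_cancel_left] at this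
    exact isRationalForm_of_mem_dualLattice hVQ L hL this
  have hratpoly : ∀ P, IsFace (dualHull C L) P → IsRatPolyCone VQ (minCone (dualHull C L) P) := by
    intro P hP
    obtain ⟨F, hF, hFQ, h⟩ := hpoly P hP
    exact ⟨isCone_minCone, h ▸ isRationalPolyhedron_of_finite hF hFQ⟩
  have hsub : ∀ P, IsFace (dualHull C L) P → minCone (dualHull C L) P ⊆ rationalHull VQ C := by
    intro P hP
    obtain ⟨F, hF, hFQ, h⟩ := hpoly P hP
    obtain ⟨X, -, hXQ, hX⟩ := exists_rational_generators hVQ hF hFQ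
    rw [h, hX]
    refine hull_subset_rationalHull hC_cone fun x hx => ⟨?_, hXQ hx⟩
    refine minCone_subset_closure L hC_cone hC_convex hne hP.nonempty ?_
    rw [h, hX]
    exact Submodule.subset_span hx
  have hint : ∀ P, IsFace (dualHull C L) P → ∀ x,
      x ∈ intrinsicInterior ℝ (minCone (dualHull C L) P) ↔ minFace (dualHull C L) x = P := by
    intro P hP x
    obtain ⟨p, F, hF, -⟩ := hgen P hP
    exact hF.mem_intrinsicInterior_iff hK hP
  have hinj : ∀ P Q, IsFace (dualHull C L) P → IsFace (dualHull C L) Q →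
      minCone (dualHull C L) P = minCone (dualHull C L) Q → P = Q := by
    intro P Q hP hQ hPQ
    obtain ⟨p, F, hF, -⟩ := hgen P hP
    obtain ⟨x, hx⟩ := hF.exists_minFace_eq hK hP
    have := (hint P hP x).2 hx
    rw [hPQ, hint Q hQ] at this
    exact hx.symm.trans this
  have hmin : ∀ x ∈ rationalHull VQ C, IsFace (dualHull C L) (minFace (dualHull C L) x) :=
    fun x hx => isFace_minFace hK (minFace_nonempty L hVQ hL hA hx)
  refine ⟨fun P hP => ⟨hratpoly P hP, ?_⟩, fun P hP Q hQ h => hinj P Q hP hQ h,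
    fun P Q _ _ h => minCone_anti h, ?_⟩
  · obtain ⟨p, F, hF, -⟩ := hgen P hP
    exact hF.dim_minCone_add_dim hK hP
  refine { isCone := ?_, convex := ?_, subset := ?_, disjoint := ?_, iUnion_eq := ?_,
           sInter_mem := ?_, face_mem := ?_, finite_restrict := ?_, ratPoly_restrict := ?_,
           ratPoly := ?_ }
  · rintro _ ⟨P, -, rfl⟩
    exact isCone_minCone
  · rintro _ ⟨P, -, rfl⟩
    exact convex_minCone
  · rintro _ ⟨P, hP, rfl⟩
    exact hsub P hP
  · rintro _ ⟨P, hP, rfl⟩ _ ⟨Q, hQ, rfl⟩ hPQ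
    refine Set.disjoint_left.2 fun x hxP hxQ => hPQ ?_
    rw [← (hint P hP x).1 hxP, ← (hint Q hQ x).1 hxQ]
  · refine Set.Subset.antisymm (Set.iUnion₂_subset ?_) fun x hx => ?_
    · rintro _ ⟨P, hP, rfl⟩
      exact intrinsicInterior_subset.trans (hsub P hP)
    · exact Set.mem_iUnion₂.2 ⟨_, ⟨_, hmin x hx, rfl⟩, (hint _ (hmin x hx) x).2 rfl⟩
  · rintro T hT ⟨s, hs⟩
    set faces := {P | IsFace (dualHull C L) P ∧ sigma C L P ∈ T}
    have hU : ⋂₀ T = minCone (dualHull C L) (⋃₀ faces) := by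
      ext x
      constructor
      · rintro hx p ⟨P, ⟨-, hPT⟩, hp⟩
        exact hx _ hPT p hp
      · intro hx t ht
        obtain ⟨P, hP, rfl⟩ := hT ht
        have hPf : P ∈ faces := ⟨hP, ht⟩
        exact minCone_anti (Set.subset_sUnion_of_mem hPf) hx
    obtain ⟨P, hP, rfl⟩ := hT hs
    have hPf : P ∈ faces := ⟨hP, hs⟩
    obtain ⟨Q, hQ, h⟩ := exists_face_minCone_eq hK
      (hP.nonempty.mono (Set.subset_sUnion_of_mem hPf))
      (Set.sUnion_subset fun G hG => hG.1.isExtreme.subset)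
    exact ⟨Q, hQ, hU.trans h⟩
  · rintro _ ⟨P, hP, rfl⟩ F hF
    obtain ⟨x, hx⟩ := hF.nonempty.intrinsicInterior hF.convex
    have hx' := hmin x (hsub P hP (hF.isExtreme.subset (intrinsicInterior_subset hx)))
    exact ⟨_, hx', eq_minCone_of_isFace hP.nonempty hP.isExtreme.subset hF hx
      ((hint _ hx' x).2 rfl)⟩
  · intro R hR hRD
    obtain ⟨F, hF, hFQ, h⟩ := hR.exists_homogeneous
    obtain ⟨X, hX, hXQ, hFX⟩ := exists_rational_generators hVQ hF hFQ
    have hRX : R = PointedCone.hull ℝ X := h.trans hFX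
    have hXC : X ⊆ closure C ∩ VQ := fun x hx =>
      ⟨rationalHull_subset_closure hC_convex (hRD (hRX ▸ Submodule.subset_span hx)), hXQ hx⟩
    -- Each restriction is an intersection of sets from one finite family, one for each lattice
    -- point in the finite description of the face.
    refine ((finite_minimality_sets L hVQ hL hX hXC).powerset.image Set.sInter).subset ?_
    rintro _ ⟨_, ⟨P, hP, rfl⟩, rfl⟩
    obtain ⟨p, F, -, -, T, hTA, ⟨a₀, ha₀⟩, hT⟩ := hgen P hP
    refine ⟨(fun a => {x ∈ (PointedCone.hull ℝ X : Set V) |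
      ∀ ξ ∈ openDual C ∩ dualLattice L, a x ≤ ξ x}) '' T, ?_, ?_⟩
    · rintro _ ⟨a, ha, rfl⟩
      exact ⟨a, hTA ha, rfl⟩
    · ext x
      rw [Set.sInter_image, hRX, Set.mem_iInter₂]
      constructor
      · exact fun hx => ⟨(hT x).2 fun a ha => (hx a ha).2, (hx a₀ ha₀).1⟩
      · exact fun hx a ha => ⟨hx.2, (hT x).1 hx.1 a ha⟩
  · rintro R hR - _ ⟨P, hP, rfl⟩
    obtain ⟨F, hF, hFQ, h⟩ := hR.exists_homogeneous
    obtain ⟨G, hG, hGQ, h'⟩ := hpoly P hP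
    have heq : sigma C L P ∩ R = {x | ∀ f ∈ G ∪ F, 0 ≤ f x} := by
      rw [hsigma, h', h]
      ext x
      simp only [Set.mem_inter_iff, Set.mem_ofPred_eq, Set.mem_union, or_imp, forall_and]
    rw [heq]
    refine ⟨⟨⟨0, fun f _ => by simp⟩, fun t ht x hx f hf => ?_⟩,
      isRationalPolyhedron_of_finite (hG.union hF) (fun f hf => hf.elim (hGQ f) (hFQ f))⟩
    rw [map_smul]
    exact mul_nonneg ht.le (hx f hf)
  · rintro _ ⟨P, hP, rfl⟩
    exact hratpoly P hP
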